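/- Let $n>2$ and let $S\subset\mathbb C^n$ be a simply-connected, strongly $\mathbb C$-convex smooth real hypersurface (i.e. $S$ is locally projectively equivalent to a strongly convex hypersurface; $S$ need not be compact or closed). For $p\in S$ let $H_pS=T_pS\cap iT_pS$ be the maximal complex subspace of $T_pS$, and assume that no complex tangent hyperplane $p+H_pS$ passes through the origin. For a local defining function $\rho$ of $S$ put $$w_j=\frac{\partial\rho/\partial z_j}{\sum_{i} z_i\,\partial\rho/\partial z_i}\qquad(j=1,\dots,n);$$ along $S$ these functions do not depend on $\rho$. The projective dual CR structure on $S$ is the unique CR structure, with the same spaces $H_pS$, for which $w_1,\dots,w_n$ are CR: it is given by the complex structures $J^*_p$ on the real vector spaces $H_pS$ with $dw_j\circ J^*_p=i\,dw_j$ on $H_pS$ for all $j$. A smooth function $f\colon S\to\mathbb C$ is CR if $df(iv)=i\,df(v)$, and dual-CR if $df(J^*_pv)=i\,df(v)$, for all $p\in S$ and $v\in H_pS$. For $j\ne k$ let $X_{jk}$ and $T_{jk}$ be the uniquely determined tangential vector fields on $S$ (sections of $TS\otimes\mathbb C$) such that $$X_{jk}z_m=0,\quad X_{jk}w_j=z_k,\quad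 X_{jk}w_k=-z_j,\quad X_{jk}w_m=0\ \ (m\ne j,k),$$ $$T_{jk}w_m=0,\quad T_{jk}z_j=w_k,\quad T_{jk}z_k=-w_j,\quad T_{jk}z_m=0\ \ (m\ne j,k),$$ where the equations $X_{jk}z_m=0$ and $T_{jk}w_m=0$ hold for all $m$; and for distinct $j,k,\ell$ let $\tilde T_{jk\ell}=z_jT_{\ell j}+z_kT_{\ell k}$. Assume that $z_jw_j+z_kw_k\ne0$ at every point of $S$ for all $j,k\in\{1,\dots,n\}$ (including $j=k$). Then for every smooth $u\colon S\to\mathbb C$ the following are equivalent: (a) $u=f+g$ on $S$ for some CR function $f$ and some dual-CR function $g$ on $S$; (b) $X_{jk}\tilde T_{jk\ell}u=0$ on $S$ for all distinct $j,k,\ell$. -/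

import Mathlib

open scoped ContDiff Topology

noncomputable section

namespace DualCR

/-- Affine complex `n`-space. -/
abbrev Cn (n : ℕ) : Type := Fin n → ℂ

variable {n : ℕ}

/-! ### Smooth real hypersurfaces -/

/-- `ρ` is a smooth real-valued defining function for `S` in some neighbourhood of `p`. -/
def IsLocalDefiningFunction (S : Set (Cn n)) (p : Cn n) (ρ : Cn n → ℝ) : Prop :=
  ∃ U : Set (Cn n), IsOpen U ∧ p ∈ U ∧ ContDiffOn ℝ ∞ ρ U ∧
    (∀ z ∈ U, (z ∈ S ↔ ρ z = 0)) ∧ (∀ z ∈ U ∩ S, fderiv ℝ ρ z ≠ 0)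

/-- `S` is a smooth (embedded, not necessarily closed) real hypersurface of `ℂⁿ`. -/
def IsSmoothHypersurface (S : Set (Cn n)) : Prop :=
  ∀ p ∈ S, ∃ ρ : Cn n → ℝ, IsLocalDefiningFunction S p ρ

/-- A choice of defining function for `S` near `p`. -/
def definingFunction (S : Set (Cn n)) (p : Cn n) : Cn n → ℝ :=
  Classical.epsilon (IsLocalDefiningFunction S p)

/-- The real tangent space `T_p S` (for `p ∈ S`). -/
def tangent (S : Set (Cn n)) (p : Cn n) : Submodule ℝ (Cn n) :=
  LinearMap.ker (fderiv ℝ (definingFunction S p) p).toLinearMap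

/-- The maximal complex subspace `H_p S = T_p S ∩ J T_p S`. -/
def cTangent (S : Set (Cn n)) (p : Cn n) : Submodule ℂ (Cn n) where
  carrier := {v | v ∈ tangent S p ∧ Complex.I • v ∈ tangent S p}
  zero_mem' := by simp
  add_mem' := by
    rintro v w ⟨hv, hv'⟩ ⟨hw, hw'⟩
    exact ⟨add_mem hv hw, by rw [smul_add]; exact add_mem hv' hw'⟩
  smul_mem' := by
    rintro c v ⟨hv, hv'⟩
    have e1 : c • v = c.re • v + c.im • (Complex.I • v) := by
      ext i
      simp only [Pi.smul_apply, Pi.add_apply, smul_eq_mul, Complex.real_smul]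
      conv_lhs => rw [← Complex.re_add_im c]
      ring
    have e2 : Complex.I • (c • v) = c.re • (Complex.I • v) + (-c.im) • v := by
      ext i
      simp only [Pi.smul_apply, Pi.add_apply, smul_eq_mul, Complex.real_smul]
      conv_lhs => rw [← Complex.re_add_im c]
      push_cast
      linear_combination (c.im * v i) * Complex.I_mul_I
    refine ⟨?_, ?_⟩
    · rw [e1]
      exact add_mem (Submodule.smul_mem _ _ hv) (Submodule.smul_mem _ _ hv')
    · rw [e2]
      exact add_mem (Submodule.smul_mem _ _ hv') (Submodule.smul_mem _ _ hv)

/-! ### Strong `ℂ`-convexity -/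

/-- `S` is a strongly convex real hypersurface: the second fundamental form is definite, that is,
near each point there is a defining function whose real Hessian is positive definite on the
tangent space at that point. -/
def IsStronglyConvexHypersurface (S : Set (Cn n)) : Prop :=
  ∀ p ∈ S, ∃ ρ : Cn n → ℝ, IsLocalDefiningFunction S p ρ ∧
    ∀ v : Cn n, v ≠ 0 → fderiv ℝ ρ p v = 0 → 0 < fderiv ℝ (fderiv ℝ ρ) p v v

/-- The denominator of the projective transformation given by the matrix `M`, in the affine chart
`z ↦ [1 : z₁ : … : z_n]`. -/
def projDenom (M : Matrix (Fin (n + 1)) (Fin (n + 1)) ℂ) (z : Cn n) : ℂ :=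
  M.mulVec (Matrix.vecCons 1 z) 0

/-- The projective transformation given by the matrix `M`, in the affine chart
`z ↦ [1 : z₁ : … : z_n]`; meaningful where `projDenom M z ≠ 0`. -/
def projMap (M : Matrix (Fin (n + 1)) (Fin (n + 1)) ℂ) (z : Cn n) : Cn n :=
  fun j => M.mulVec (Matrix.vecCons 1 z) j.succ / projDenom M z

/-- `S` is strongly `ℂ`-convex: a smooth hypersurface that is locally projectively equivalent to a
strongly convex hypersurface. -/
def IsStronglyCConvex (S : Set (Cn n)) : Prop :=
  IsSmoothHypersurface S ∧
  ∀ p ∈ S, ∃ U : Set (Cn n), IsOpen U ∧ p ∈ U ∧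
    ∃ M : Matrix (Fin (n + 1)) (Fin (n + 1)) ℂ, M.det ≠ 0 ∧
      (∀ z ∈ U, projDenom M z ≠ 0) ∧ IsStronglyConvexHypersurface (projMap M '' (S ∩ U))

/-! ### The dual coordinates `w_j` -/

/-- No complex tangent hyperplane `p + H_p S` of `S` passes through the origin. -/
def ComplexTangentsAvoidOrigin (S : Set (Cn n)) : Prop :=
  ∀ p ∈ S, ∀ v ∈ cTangent S p, p + v ≠ 0

/-- The Wirtinger derivative `∂ρ/∂z_j` at `p`. -/
def wirtinger (ρ : Cn n → ℝ) (p : Cn n) (j : Fin n) : ℂ :=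
  (1 / 2) * ((fderiv ℝ ρ p (Pi.single j 1) : ℂ)
    - Complex.I * (fderiv ℝ ρ p (Pi.single j Complex.I) : ℂ))

/-- `(∂ρ/∂z_j) / (z₁ ∂ρ/∂z₁ + … + z_n ∂ρ/∂z_n)` at `p`. -/
def dualFormula (ρ : Cn n → ℝ) (p : Cn n) (j : Fin n) : ℂ :=
  wirtinger ρ p j / ∑ i, p i * wirtinger ρ p i

/-- The functions `w_j` on `S` (argument order: `dualCoord S j z = w_j(z)`). -/
def dualCoord (S : Set (Cn n)) (j : Fin n) (p : Cn n) : ℂ :=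
  dualFormula (definingFunction S p) p j

/-- The differentials at `p` of two defining functions are proportional. -/
theorem IsLocalDefiningFunction.fderiv_eq_smul {S : Set (Cn n)} {p : Cn n} (hp : p ∈ S)
    {ρ σ : Cn n → ℝ} (hρ : IsLocalDefiningFunction S p ρ) (hσ : IsLocalDefiningFunction S p σ) :
    ∃ c : ℝ, c ≠ 0 ∧ fderiv ℝ σ p = c • fderiv ℝ ρ p := by
  obtain ⟨U, hU, hpU, hρs, hρ0, hρd⟩ := hρ
  obtain ⟨V, hV, hpV, hσs, hσ0, hσd⟩ := hσ
  have h1 : HasStrictFDerivAt ρ (fderiv ℝ ρ p) p :=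
    (hρs.contDiffAt (hU.mem_nhds hpU)).hasStrictFDerivAt (by simp)
  have h2 : HasStrictFDerivAt σ (fderiv ℝ σ p) p :=
    (hσs.contDiffAt (hV.mem_nhds hpV)).hasStrictFDerivAt (by simp)
  have hext : IsLocalExtrOn σ {x | ρ x = ρ p} p := by
    left
    have hn : U ∩ V ∈ 𝓝[{x | ρ x = ρ p}] p :=
      mem_nhdsWithin_of_mem_nhds ((hU.inter hV).mem_nhds ⟨hpU, hpV⟩)
    filter_upwards [hn, self_mem_nhdsWithin] with x hx hx'
    have hxS : x ∈ S := (hρ0 x hx.1).2 (by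
      have : ρ x = ρ p := hx'
      rw [this]; exact (hρ0 p hpU).1 hp)
    rw [(hσ0 x hx.2).1 hxS, (hσ0 p hpV).1 hp]
  obtain ⟨a, b, hab, h⟩ := hext.exists_multipliers_of_hasStrictFDerivAt_1d h1 h2
  have hρne := hρd p ⟨hpU, hp⟩
  have hσne := hσd p ⟨hpV, hp⟩
  have hb : b ≠ 0 := by
    rintro rfl
    have ha : a ≠ 0 := by
      rintro rfl
      exact hab rfl
    simp [ha, hρne] at h
  have ha : a ≠ 0 := by
    rintro rfl
    simp [hb, hσne] at h
  refine ⟨-(b⁻¹ * a), by simp [ha, hb], ?_⟩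
  have h' : b • fderiv ℝ σ p = -(a • fderiv ℝ ρ p) := by
    rw [eq_neg_iff_add_eq_zero, add_comm]; exact h
  have h2 : b⁻¹ • (b • fderiv ℝ σ p) = b⁻¹ • -(a • fderiv ℝ ρ p) := by rw [h']
  rw [smul_smul, inv_mul_cancel₀ hb, one_smul] at h2
  rw [h2, smul_neg, smul_smul]
  exact (neg_smul (b⁻¹ * a) (fderiv ℝ ρ p)).symm

/-- The tangent space does not depend on the choice of defining function. -/
theorem mem_tangent_iff {S : Set (Cn n)} {p : Cn n} (hp : p ∈ S) {ρ : Cn n → ℝ}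
    (hρ : IsLocalDefiningFunction S p ρ) (v : Cn n) :
    v ∈ tangent S p ↔ fderiv ℝ ρ p v = 0 := by
  have hc : IsLocalDefiningFunction S p (definingFunction S p) :=
    Classical.epsilon_spec (p := IsLocalDefiningFunction S p) ⟨ρ, hρ⟩
  obtain ⟨c, hc0, h⟩ := hρ.fderiv_eq_smul hp hc
  simp [tangent, h, hc0]

/-- The `w_j` do not depend on the choice of defining function. -/
theorem dualCoord_eq {S : Set (Cn n)} {p : Cn n} (hp : p ∈ S) {ρ : Cn n → ℝ}
    (hρ : IsLocalDefiningFunction S p ρ) (j : Fin n) :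
    dualCoord S j p = dualFormula ρ p j := by
  have hc : IsLocalDefiningFunction S p (definingFunction S p) :=
    Classical.epsilon_spec (p := IsLocalDefiningFunction S p) ⟨ρ, hρ⟩
  obtain ⟨c, hc0, h⟩ := hρ.fderiv_eq_smul hp hc
  have hw : ∀ i, wirtinger (definingFunction S p) p i = c * wirtinger ρ p i := by
    intro i
    simp only [wirtinger, h, smul_apply, smul_eq_mul]
    push_cast
    ring
  have hs : ∑ i, p i * wirtinger (definingFunction S p) p i
      = c * ∑ i, p i * wirtinger ρ p i := by
    rw [Finset.mul_sum]
    exact Finset.sum_congr rfl fun i _ => by rw [hw]; ring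
  have hc' : (c : ℂ) ≠ 0 := by exact_mod_cast hc0
  simp only [dualCoord, dualFormula]
  rw [hs, hw, mul_div_mul_left _ _ hc']

/-! ### Functions on `S`, CR and dual-CR functions

A function on `S` is represented by a function on `ℂⁿ` of which only the values on `S` matter. -/

/-- `u` is a smooth function on `S`: near each point of `S` it agrees on `S` with a smooth function
defined on an open subset of `ℂⁿ`. -/
def IsSmoothFunOn (S : Set (Cn n)) (u : Cn n → ℂ) : Prop :=
  ∀ p ∈ S, ∃ U : Set (Cn n), IsOpen U ∧ p ∈ U ∧
    ∃ v : Cn n → ℂ, ContDiffOn ℝ ∞ v U ∧ ∀ z ∈ S ∩ U, u z = v z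

/-- The differential at `p ∈ S` of a function `u` on `S`.  It is only ever evaluated on vectors
tangent to `S`, where it depends on nothing but `u` on `S`. -/
def tDeriv (S : Set (Cn n)) (u : Cn n → ℂ) (p v : Cn n) : ℂ :=
  fderivWithin ℝ u S p v

/-- `tDeriv` along tangent vectors is computed by any differentiable extension of `u`. -/
theorem tDeriv_eq {S : Set (Cn n)} {p : Cn n} (hp : p ∈ S) {ρ : Cn n → ℝ}
    (hρ : IsLocalDefiningFunction S p ρ) {u w : Cn n → ℂ} (hw : DifferentiableAt ℝ w p)
    (huw : u =ᶠ[𝓝[S] p] w) {v : Cn n} (hv : v ∈ tangent S p) :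
    tDeriv S u p v = fderiv ℝ w p v := by
  rw [mem_tangent_iff hp hρ] at hv
  obtain ⟨U, hU, hpU, hρs, hρ0, hρd⟩ := hρ
  have h1 : HasStrictFDerivAt ρ (fderiv ℝ ρ p) p :=
    (hρs.contDiffAt (hU.mem_nhds hpU)).hasStrictFDerivAt (by simp)
  have hsurj : (fderiv ℝ ρ p).range = ⊤ := by
    refine LinearMap.range_eq_top.2 (LinearMap.surjective ?_)
    exact fun h => hρd p ⟨hpU, hp⟩ (ContinuousLinearMap.coe_injective h)
  have h2 : HasFDerivWithinAt u (fderiv ℝ w p) S p :=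
    (hw.hasFDerivAt.hasFDerivWithinAt).congr_of_eventuallyEq huw
      (huw.self_of_nhdsWithin hp)
  have h3 : HasFDerivWithinAt u (fderivWithin ℝ u S p) S p :=
    h2.differentiableWithinAt.hasFDerivWithinAt
  let φ : (fderiv ℝ ρ p).ker → Cn n := h1.implicitFunction ρ (fderiv ℝ ρ p) hsurj (ρ p)
  let v' : (fderiv ℝ ρ p).ker := ⟨v, hv⟩
  have hφ : HasStrictFDerivAt φ (fderiv ℝ ρ p).ker.subtypeL 0 := h1.to_implicitFunction hsurj
  have hφ0 : φ 0 = p := h1.implicitFunction_apply_image hsurj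
  have hφS : ∀ᶠ x in 𝓝 (0 : (fderiv ℝ ρ p).ker), φ x ∈ S := by
    have ha : ∀ᶠ x in 𝓝 (0 : (fderiv ℝ ρ p).ker), ρ (φ x) = ρ p := by
      have := h1.map_implicitFunction_eq hsurj
      have ht : Filter.Tendsto (fun x : (fderiv ℝ ρ p).ker => (ρ p, x)) (𝓝 0)
          (𝓝 (ρ p, 0)) := (Continuous.prodMk_right (ρ p)).tendsto 0
      exact ht.eventually this
    have hb : ∀ᶠ x in 𝓝 (0 : (fderiv ℝ ρ p).ker), φ x ∈ U :=
      hφ.hasFDerivAt.continuousAt.eventually (by rw [hφ0]; exact hU.mem_nhds hpU)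
    filter_upwards [ha, hb] with x hx hx'
    exact (hρ0 _ hx').2 (by rw [hx]; exact (hρ0 p hpU).1 hp)
  have hγ : HasDerivAt (fun t : ℝ => t • v') v' 0 := by
    simpa using (hasDerivAt_id (0 : ℝ)).smul_const v'
  have hφ' : HasFDerivAt φ (fderiv ℝ ρ p).ker.subtypeL ((0 : ℝ) • v') := by
    rw [zero_smul]; exact hφ.hasFDerivAt
  have hc : HasDerivAt (fun t : ℝ => φ (t • v')) v 0 := by
    have := HasFDerivAt.comp_hasDerivAt (f := fun t : ℝ => t • v') (0 : ℝ) hφ' hγ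
    exact this
  have hcS : ∀ᶠ t : ℝ in 𝓝 0, φ (t • v') ∈ S := by
    have := hγ.continuousAt.eventually (p := fun x => φ x ∈ S) (by simpa using hφS)
    simpa using this
  have key : ∀ L : Cn n →L[ℝ] ℂ, HasFDerivWithinAt u L S p →
      HasDerivWithinAt (fun t : ℝ => u (φ (t • v'))) (L v) {t : ℝ | φ (t • v') ∈ S} 0 := by
    intro L hL
    have hL' : HasFDerivWithinAt u L S (φ ((0 : ℝ) • v')) := by
      rw [zero_smul, hφ0]; exact hL
    exact hL'.comp_hasDerivWithinAt (0 : ℝ) hc.hasDerivWithinAt (fun t ht => ht)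
  exact ((key _ h3).hasDerivAt hcS).unique ((key _ h2).hasDerivAt hcS)

/-- A field of endomorphisms of the maximal complex tangent spaces. -/
abbrev EndField (S : Set (Cn n)) : Type :=
  ∀ p : Cn n, cTangent S p →ₗ[ℝ] cTangent S p

/-- The complex structure tensor of `ℂⁿ`, restricted to `H S`. -/
def stdJ (S : Set (Cn n)) : EndField S :=
  fun p => (LinearMap.lsmul ℂ (cTangent S p) Complex.I).restrictScalars ℝ

/-- The differential of `u`, restricted to `H S`, is `ℂ`-linear with respect to `J`. -/
def IsLinearWrt (S : Set (Cn n)) (J : EndField S) (u : Cn n → ℂ) : Prop :=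
  ∀ p ∈ S, ∀ v : cTangent S p, tDeriv S u p (J p v) = Complex.I * tDeriv S u p v

/-- (Smooth) CR functions on `S`. -/
def IsCR (S : Set (Cn n)) (u : Cn n → ℂ) : Prop :=
  IsSmoothFunOn S u ∧ IsLinearWrt S (stdJ S) u

/-- `J` is the projective dual CR structure on `S`: a complex structure on `H S` for which all the
functions `w_j` are CR. -/
def IsDualStructure (S : Set (Cn n)) (J : EndField S) : Prop :=
  (∀ p ∈ S, ∀ v : cTangent S p, J p (J p v) = -v) ∧ ∀ j, IsLinearWrt S J (dualCoord S j)

/-- (Smooth) dual-CR functions on `S`: CR functions for the projective dual CR structure. -/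
def IsDualCR (S : Set (Cn n)) (u : Cn n → ℂ) : Prop :=
  IsSmoothFunOn S u ∧ ∃ J : EndField S, IsDualStructure S J ∧ IsLinearWrt S J u

/-! ### The tangential vector fields `X_{jk}`, `T_{jk}` and `T̃_{jkℓ}` -/

/-- A complex tangent vector `a + i b` (with `a`, `b` real tangent vectors) is the pair `(a, b)`. -/
abbrev CVec (n : ℕ) : Type := Cn n × Cn n

/-- `V` lies in `T_p S ⊗ ℂ`. -/
def IsTangential (S : Set (Cn n)) (p : Cn n) (V : CVec n) : Prop :=
  V.1 ∈ tangent S p ∧ V.2 ∈ tangent S p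

/-- The derivative `V u` of a function `u` on `S` along a complex vector field `V`. -/
def along (S : Set (Cn n)) (V : Cn n → CVec n) (u : Cn n → ℂ) (p : Cn n) : ℂ :=
  tDeriv S u p (V p).1 + Complex.I * tDeriv S u p (V p).2

/-- `V` is a tangential vector field on `S` with `V z_ℓ = a_ℓ` and `V w_ℓ = b_ℓ` for all `ℓ`. -/
def IsFieldWith (S : Set (Cn n)) (a b : Fin n → Cn n → ℂ) (V : Cn n → CVec n) : Prop :=
  ∀ p ∈ S, IsTangential S p (V p) ∧
    ∀ l, along S V (fun z => z l) p = a l p ∧ along S V (dualCoord S l) p = b l p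

/-- The functions `c_k` (for `ℓ = j`), `-c_j` (for `ℓ = k`), `0` (otherwise). -/
def rotCoeff (c : Fin n → Cn n → ℂ) (j k l : Fin n) (p : Cn n) : ℂ :=
  if l = j then c k p else if l = k then - c j p else 0

open Classical in
/-- The tangential field `X_{jk}`: it kills all `z_ℓ`, and `X_{jk} w_j = z_k`, `X_{jk} w_k = -z_j`,
`X_{jk} w_ℓ = 0` otherwise.  By convention `X_{jj} = 0`. -/
def fieldX (S : Set (Cn n)) (j k : Fin n) : Cn n → CVec n :=
  if j = k then 0 else
    Classical.epsilon (IsFieldWith S (fun _ _ => 0) (rotCoeff (fun i z => z i) j k))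

open Classical in
/-- The tangential field `T_{jk}`: it kills all `w_ℓ`, and `T_{jk} z_j = w_k`, `T_{jk} z_k = -w_j`,
`T_{jk} z_ℓ = 0` otherwise.  By convention `T_{jj} = 0`. -/
def fieldT (S : Set (Cn n)) (j k : Fin n) : Cn n → CVec n :=
  if j = k then 0 else
    Classical.epsilon (IsFieldWith S (rotCoeff (dualCoord S) j k) (fun _ _ => 0))

/-- Multiplication of a complex tangent vector by a complex scalar. -/
def csmul (c : ℂ) (V : CVec n) : CVec n :=
  (c.re • V.1 - c.im • V.2, c.im • V.1 + c.re • V.2)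

/-- The tangential field `T̃_{jkℓ} = z_j T_{ℓj} + z_k T_{ℓk}`. -/
def fieldTt (S : Set (Cn n)) (j k l : Fin n) : Cn n → CVec n :=
  fun z => csmul (z j) (fieldT S l j z) + csmul (z k) (fieldT S l k z)

end DualCR

end

open DualCR

/-!
Since `∑ z_j w_j = 1` on `S`, the map `(z, w)` realizes `S` as a maximally totally real submanifold
of the complex quadric `{z · w = 1}`.  Concretely: if `z_{p₀}` has no zeros, then the differentials
of all the `z_j` and of the `w_j` with `j ≠ p₀` form a coframe of `TS ⊗ ℂ`, and so a smooth function
on `S` has partial derivatives with respect to these `2n - 1` functions, which commute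
(`partialDeriv_comm`).  That these differentials are independent is the transversality of the two
CR structures (`eq_zero_of_tDeriv_dualCoord_I_smul`), which expresses the positivity of the Levi
form.  Strong `ℂ`-convexity enters only through a defining function whose real Hessian is positive
on the maximal complex subspaces (`IsStronglyCConvex.hasPositiveHessian`).

Write `Z_j`, `W_j` for these derivations, with `W_{p₀} = 0`.  Then `X_{jk} = z_k W_j - z_j W_k` and
`T_{jk} = w_k Z_j - w_j Z_k`; a function is CR if all `W_j` annihilate it, and dual-CR if all
`T_{jk}` do.  The theorem becomes a statement about commuting derivations of a commutative algebra
(`IsDualFrame`).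

If `u = f + g`, then `T̃_{jkl} u = T̃_{jkl} f`, and `X_{jk} T̃_{jkl} f = 0` because the `W_i` annihilate
the functions `Z_m f`.

Conversely, `f` is sought as a primitive of a closed form `∑ C_j dz_j` with `C_j = Z_j u - λ w_j`;
this shape is what `T_{jk} f = T_{jk} u` means.  The hypothesis on `u` says that a certain bilinear
form on the pairs (vector in the span of the `X_{jk}`, vector in the span of the `T_{jk}`) vanishes
on sufficiently many pairs that are orthogonal for the Levi form; by `exists_X_Z_eq` each `X_{jk}`
is then an eigenvector of the bilinear form relative to the Levi form, and the linear relations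
between the `X_{jk}` force all eigenvalues to be one function `λ` (`exists_W_Z_eq`).  For this `λ`
the form is closed: its differential is a multiple of the contact form, and in at least three
variables such a closed form has to vanish, the contact form being nondegenerate
(`exists_W_eq_zero`, `Z_comm_of_W_eq_zero`).  As `S` is simply connected, the closed form has a
primitive `f` (`exists_primitive`), obtained by gluing local primitives along a section of a covering
space.  Then `f` is CR, and the restriction to the maximal complex subspaces of the differential of
`g = u - f` is a combination of the `dw_j`, so that `g` is dual-CR.
-/

noncomputable section

namespace DualCR

/-! ### Commuting derivations attached to the coframe -/

/-- The algebraic skeleton of the situation.  In a commutative algebra `A` (the smooth functions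
on `S`) there are elements `z j`, `w j` with `∑ z j * w j = 1`, and the derivations `Z j`, `W j`
are the partial derivatives for the coordinate system formed by all the `z j` and by the `w j`
with `j ≠ p₀`; the derivation `W p₀` is `0` by convention. -/
structure IsDualFrame {A ι : Type*} [CommRing A] [Algebra ℂ A] [Fintype ι] [DecidableEq ι]
    (p₀ : ι) (z w : ι → A) (Z W : ι → Derivation ℂ A A) : Prop where
  sum_mul : ∑ j, z j * w j = 1
  isUnit : ∀ j, IsUnit (z j)
  isUnit_pair : ∀ j k, IsUnit (z j * w j + z k * w k)
  Z_z : ∀ j k, Z j (z k) = if j = k then 1 else 0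
  W_z : ∀ j k, W j (z k) = 0
  Z_w : ∀ j k, k ≠ p₀ → Z j (w k) = 0
  W_w : ∀ j k, j ≠ p₀ → k ≠ p₀ → W j (w k) = if j = k then 1 else 0
  W_pole : W p₀ = 0
  comm_ZZ : ∀ j k a, Z j (Z k a) = Z k (Z j a)
  comm_WZ : ∀ j k a, W j (Z k a) = Z k (W j a)
  comm_WW : ∀ j k a, W j (W k a) = W k (W j a)

namespace IsDualFrame

section

variable {A ι : Type*} [CommRing A] [Algebra ℂ A]

/-- The derivation `X_{jk} = z_k ∂/∂w_j - z_j ∂/∂w_k`. -/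
def X (z : ι → A) (W : ι → Derivation ℂ A A) (j k : ι) : Derivation ℂ A A :=
  z k • W j - z j • W k

/-- The operator `T̃_{jkl} = z_j T_{lj} + z_k T_{lk}`, where `T_{jk} = w_k ∂/∂z_j - w_j ∂/∂z_k`. -/
def Tt (z w : ι → A) (Z : ι → Derivation ℂ A A) (j k l : ι) (u : A) : A :=
  z j * (w j * Z l u - w l * Z j u) + z k * (w k * Z l u - w l * Z k u)

theorem X_apply {z : ι → A} {W : ι → Derivation ℂ A A} (j k : ι) (a : A) :
    X z W j k a = z k * W j a - z j * W k a := by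
  simp [X]

theorem derivation_mul (D : Derivation ℂ A A) (a b : A) : D (a * b) = a * D b + b * D a := by
  simp

theorem exists_ne_ne [Fintype ι] [DecidableEq ι] (hcard : 2 < Fintype.card ι) (i j : ι) :
    ∃ k, k ≠ i ∧ k ≠ j := by
  have : ({i, j} : Finset ι).card < (Finset.univ : Finset ι).card :=
    lt_of_le_of_lt Finset.card_le_two (by simpa using hcard)
  obtain ⟨k, -, hk⟩ := Finset.exists_mem_notMem_of_card_lt_card this
  exact ⟨k, by simpa [not_or] using hk⟩

end

variable {A ι : Type*} [CommRing A] [Algebra ℂ A] [Fintype ι] [DecidableEq ι]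
  {p₀ : ι} {z w : ι → A} {Z W : ι → Derivation ℂ A A} (h : IsDualFrame p₀ z w Z W)

include h

theorem W_pole_apply (a : A) : W p₀ a = 0 := by rw [h.W_pole]; rfl

theorem sum_z_mul_W_w (j : ι) : ∑ k, z k * W j (w k) = 0 := by
  have := congrArg (W j) h.sum_mul
  simpa [h.W_z] using this

theorem pole_mul_Z_w (j : ι) : z p₀ * Z j (w p₀) = -w j := by
  have h1 := congrArg (Z j) h.sum_mul
  simp only [map_sum, derivation_mul, Finset.sum_add_distrib, h.Z_z, Derivation.map_one_eq_zero] at h1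
  rw [Finset.sum_eq_single p₀ (fun b _ hb => by rw [h.Z_w j b hb, mul_zero]) (by simp)] at h1
  simp at h1
  linear_combination h1

theorem pole_mul_W_w {j : ι} (hj : j ≠ p₀) : z p₀ * W j (w p₀) = -z j := by
  have h1 := h.sum_z_mul_W_w j
  rw [← Finset.add_sum_erase _ _ (Finset.mem_univ p₀),
    Finset.sum_eq_single_of_mem j (Finset.mem_erase.2 ⟨hj, Finset.mem_univ j⟩)] at h1
  · rw [h.W_w j j hj hj] at h1
    simp at h1
    linear_combination h1
  · intro b hb hbj
    rw [h.W_w j b hj (Finset.ne_of_mem_erase hb), if_neg (Ne.symm hbj), mul_zero]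

theorem X_z (j k l : ι) : X z W j k (z l) = 0 := by simp [X_apply, h.W_z]

theorem X_w {j k : ι} (hjk : j ≠ k) (l : ι) :
    X z W j k (w l) = if l = j then z k else if l = k then -z j else 0 := by
  rw [X_apply]
  by_cases hl : l = p₀
  · subst hl
    apply (h.isUnit l).mul_left_cancel
    by_cases hj : j = l
    · subst hj
      have := h.pole_mul_W_w hjk.symm
      simp [h.W_pole_apply]
      linear_combination (-z j) * this
    · by_cases hk : k = l
      · subst hk
        have := h.pole_mul_W_w hj
        simp [h.W_pole_apply, hjk.symm]
        linear_combination (z k) * this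
      · have h1 := h.pole_mul_W_w hj
        have h2 := h.pole_mul_W_w hk
        simp [Ne.symm hj, Ne.symm hk]
        linear_combination (z k) * h1 - z j * h2
  · by_cases hj : j = p₀
    · subst hj
      rw [h.W_pole_apply, h.W_w k l hjk.symm hl, if_neg hl]
      by_cases hkl : k = l
      · simp [hkl]
      · simp [hkl, Ne.symm hkl]
    · by_cases hk : k = p₀
      · subst hk
        rw [h.W_pole_apply, h.W_w j l hj hl, if_neg hl]
        by_cases hjl : j = l
        · simp [hjl]
        · simp [hjl, Ne.symm hjl]
      · rw [h.W_w j l hj hl, h.W_w k l hk hl]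
        by_cases hjl : j = l
        · subst hjl; simp [hjk.symm]
        · by_cases hkl : k = l
          · subst hkl; simp [hjk, hjk.symm]
          · simp [hjl, hkl, Ne.symm hjl, Ne.symm hkl]

theorem sum_z_mul_X_w (j k : ι) : ∑ l, z l * X z W j k (w l) = 0 := by
  have := congrArg (X z W j k) h.sum_mul
  simpa [h.X_z] using this

/-- An identity `a * w l + b l = 0` with `∑ z l * b l = 0` forces `a = 0`. -/
theorem eq_zero_of_mul_w_add {a : A} {b : ι → A} (hab : ∀ l, a * w l + b l = 0)
    (hb : ∑ l, z l * b l = 0) : a = 0 := by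
  have h1 : ∑ l, z l * (a * w l + b l) = 0 := Finset.sum_eq_zero fun l _ => by rw [hab, mul_zero]
  have h2 : ∑ l, z l * (a * w l + b l) = a * ∑ l, z l * w l + ∑ l, z l * b l := by
    rw [Finset.mul_sum, ← Finset.sum_add_distrib]
    exact Finset.sum_congr rfl fun l _ => by ring
  rw [h2, h.sum_mul, hb] at h1
  linear_combination h1

/-- The coefficients `z_j w_j + z_k w_k`, `w_l z_j` and `w_l z_k` of `T̃_{jkl}` are annihilated by
`X_{jk}`, which therefore only acts on the functions `Z_m u`. -/
theorem X_Tt {j k l : ι} (hjk : j ≠ k) (hjl : j ≠ l) (hkl : k ≠ l) (u : A) :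
    X z W j k (Tt z w Z j k l u) = (z j * w j + z k * w k) * X z W j k (Z l u)
      - w l * (z j * X z W j k (Z j u) + z k * X z W j k (Z k u)) := by
  have e1 : X z W j k (w j) = z k := by simp [h.X_w hjk]
  have e2 : X z W j k (w k) = -z j := by simp [h.X_w hjk, hjk.symm]
  have e3 : X z W j k (w l) = 0 := by simp [h.X_w hjk, hjl.symm, hkl.symm]
  simp only [Tt, map_add, map_sub, derivation_mul, h.X_z, e1, e2, e3]
  ring

theorem X_Tt_eq_zero_of_W_eq_zero {j k l : ι} (hjk : j ≠ k) (hjl : j ≠ l) (hkl : k ≠ l) {f : A}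
    (hf : ∀ i, W i f = 0) : X z W j k (Tt z w Z j k l f) = 0 := by
  have : ∀ m, X z W j k (Z m f) = 0 := fun m => by
    rw [X_apply, h.comm_WZ, h.comm_WZ, hf, hf]; simp
  rw [h.X_Tt hjk hjl hkl, this, this, this]; ring

/-- Under the hypothesis on `u`, the gradient `(X_{jk} Z_l u)_l` is a combination of the vectors
`(w_l)_l` and `(X_{jk} w_l)_l`: the bilinear form `(X, T) ↦ X (T u)` vanishes on the pairs
`(X_{jk}, T)` that are orthogonal for the Levi form. -/
theorem exists_X_Z_eq {u : A} {j k : ι} (hjk : j ≠ k)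
    (hu : ∀ l, j ≠ l → k ≠ l → X z W j k (Tt z w Z j k l u) = 0) :
    ∃ τ σ : A, ∀ l, X z W j k (Z l u) = τ * w l + σ * X z W j k (w l) := by
  obtain ⟨e, he⟩ := h.isUnit_pair j k
  obtain ⟨c, hc⟩ := h.isUnit k
  have he' := e.inv_mul
  rw [he] at he'
  have hc' := c.inv_mul
  rw [hc] at hc'
  set e' : A := ↑e⁻¹
  set c' : A := ↑c⁻¹
  set y : ι → A := fun l => X z W j k (Z l u) with hy
  set τ : A := e' * (z j * y j + z k * y k) with hτ
  set σ : A := c' * (y j - τ * w j) with hσ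
  have hτ' : z j * y j + z k * y k = τ * (z j * w j + z k * w k) := by
    rw [hτ]; linear_combination (-(z j * y j + z k * y k)) * he'
  have hσ' : y j = τ * w j + σ * z k := by
    rw [hσ]; linear_combination (-(y j - τ * w j)) * hc'
  refine ⟨τ, σ, fun l => ?_⟩
  change y l = _
  by_cases hlj : l = j
  · subst hlj
    rw [h.X_w hjk, if_pos rfl]; exact hσ'
  · by_cases hlk : l = k
    · subst hlk
      rw [h.X_w hjk, if_neg hlj, if_pos rfl]
      linear_combination c' * hτ' - (c' * z j) * hσ' - (y l - τ * w l + σ * z j) * hc'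
    · rw [h.X_w hjk, if_neg hlj, if_neg hlk]
      have h1 := hu l (Ne.symm hlj) (Ne.symm hlk)
      rw [h.X_Tt hjk (Ne.symm hlj) (Ne.symm hlk)] at h1
      change (z j * w j + z k * w k) * y l - w l * (z j * y j + z k * y k) = 0 at h1
      rw [hτ]
      linear_combination e' * h1 - y l * he'

/-- The cyclic relation `z_l X_{jk} + z_j X_{kl} + z_k X_{lj} = 0` makes the coefficient of
`exists_X_Z_eq` independent of the pair `(j, k)`. -/
theorem exists_W_Z_eq (hcard : 2 < Fintype.card ι) {u : A}
    (hu : ∀ j k l, j ≠ k → j ≠ l → k ≠ l → X z W j k (Tt z w Z j k l u) = 0) :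
    ∃ (lam : A) (μ : ι → A), ∀ i l, W i (Z l u) = μ i * w l + lam * W i (w l) := by
  obtain ⟨c, hc⟩ := h.isUnit p₀
  have hc' := c.inv_mul
  rw [hc] at hc'
  set c' : A := ↑c⁻¹
  have key : ∀ i, i ≠ p₀ → ∃ μ σ : A, ∀ l, W i (Z l u) = μ * w l + σ * W i (w l) := by
    intro i hi
    obtain ⟨τ, σ, hτσ⟩ := h.exists_X_Z_eq hi (fun l h1 h2 => hu i p₀ l hi h1 h2)
    refine ⟨c' * τ, σ, fun l => ?_⟩
    have h1 := hτσ l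
    simp only [X_apply, h.W_pole_apply] at h1
    linear_combination c' * h1 - (W i (Z l u) - σ * W i (w l)) * hc'
  choose! μ σ hμσ using key
  have hconst : ∀ i i', i ≠ p₀ → i' ≠ p₀ → i ≠ i' → σ i = σ i' := by
    intro i i' hi hi' hii
    obtain ⟨τ, s, hτs⟩ := h.exists_X_Z_eq hii (fun l h1 h2 => hu i i' l hii h1 h2)
    have h1 : ∀ l, (z i' * μ i - z i * μ i' - τ) * w l
        + (z i' * σ i * W i (w l) - z i * σ i' * W i' (w l) - s * X z W i i' (w l)) = 0 := by
      intro l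
      have := hτs l
      rw [X_apply, hμσ i hi, hμσ i' hi'] at this
      linear_combination this
    have h2 := h.eq_zero_of_mul_w_add h1 (by
      have e1 := h.sum_z_mul_W_w i
      have e2 := h.sum_z_mul_W_w i'
      have e3 := h.sum_z_mul_X_w i i'
      have : ∑ l, z l * (z i' * σ i * W i (w l) - z i * σ i' * W i' (w l) - s * X z W i i' (w l))
          = z i' * σ i * ∑ l, z l * W i (w l) - z i * σ i' * ∑ l, z l * W i' (w l)
            - s * ∑ l, z l * X z W i i' (w l) := by
        simp only [Finset.mul_sum, ← Finset.sum_sub_distrib]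
        exact Finset.sum_congr rfl fun l _ => by ring
      rw [this, e1, e2, e3]; ring)
    have h3 := h1 i
    have h4 := h1 i'
    rw [h2, h.X_w hii, h.W_w i i hi hi, h.W_w i' i hi' hi] at h3
    rw [h2, h.X_w hii, h.W_w i i' hi hi', h.W_w i' i' hi' hi'] at h4
    simp [hii, hii.symm] at h3 h4
    have h3' : z i' * σ i = z i' * s := by linear_combination h3
    have h4' : z i * σ i' = z i * s := by linear_combination -h4
    rw [(h.isUnit i').mul_left_cancel h3', (h.isUnit i).mul_left_cancel h4']
  obtain ⟨i₀, hi₀⟩ : ∃ i, i ≠ p₀ := by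
    have : Nontrivial ι := Fintype.one_lt_card_iff_nontrivial.1 (by lia)
    exact exists_ne p₀
  refine ⟨σ i₀, fun i => if i = p₀ then 0 else μ i, fun i l => ?_⟩
  by_cases hi : i = p₀
  · subst hi; simp [h.W_pole_apply]
  · simp only [hμσ i hi l, if_neg hi]
    by_cases hii : i = i₀
    · rw [hii]
    · rw [hconst i i₀ hi hi₀ hii]

/-- The functions `C_j = Z_j u - λ w_j` do not depend on the coordinates `w_i`.  The commutation of
`W_i` with a second `W_{i'}` is what forces this, so three indices are needed. -/
theorem exists_W_eq_zero (hcard : 2 < Fintype.card ι) {u : A}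
    (hu : ∀ j k l, j ≠ k → j ≠ l → k ≠ l → X z W j k (Tt z w Z j k l u) = 0) :
    ∃ lam : A, ∀ i l, W i (Z l u - lam * w l) = 0 := by
  obtain ⟨lam, μ, hμ⟩ := h.exists_W_Z_eq hcard hu
  refine ⟨lam, fun i l => ?_⟩
  by_cases hi : i = p₀
  · subst hi; exact h.W_pole_apply _
  set ε : ι → A := fun i => μ i - W i lam with hε
  have hC : ∀ i l, W i (Z l u - lam * w l) = ε i * w l := by
    intro i l
    rw [map_sub, derivation_mul, hμ]; ring
  obtain ⟨i', hi'p, hi'i⟩ := exists_ne_ne hcard p₀ i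
  have h1 : ∀ l, (W i' (ε i) - W i (ε i')) * w l
      + (ε i * W i' (w l) - ε i' * W i (w l)) = 0 := by
    intro l
    have := h.comm_WW i' i (Z l u - lam * w l)
    rw [hC, hC, derivation_mul, derivation_mul] at this
    linear_combination this
  have h2 := h.eq_zero_of_mul_w_add h1 (by
    have : ∑ l, z l * (ε i * W i' (w l) - ε i' * W i (w l))
        = ε i * ∑ l, z l * W i' (w l) - ε i' * ∑ l, z l * W i (w l) := by
      simp only [Finset.mul_sum, ← Finset.sum_sub_distrib]
      exact Finset.sum_congr rfl fun l _ => by ring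
    rw [this, h.sum_z_mul_W_w, h.sum_z_mul_W_w]; ring)
  have h3 := h1 i'
  rw [h2, h.W_w i' i' hi'p hi'p, h.W_w i i' hi hi'p, if_neg hi'i.symm] at h3
  rw [hC]
  have : ε i = 0 := by simpa using h3
  rw [this, zero_mul]

/-- The form `∑ C_j dz_j` is closed.  Its differential is divisible by the contact form `∑ w_j dz_j`
but has coefficients that depend on the `z_j` only; the contact form being nondegenerate, the
differential vanishes. -/
theorem Z_comm_of_W_eq_zero (hcard : 2 < Fintype.card ι) {u lam : A}
    (hW : ∀ i l, W i (Z l u - lam * w l) = 0) (j k : ι) :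
    Z k (Z j u - lam * w j) = Z j (Z k u - lam * w k) := by
  by_cases hjk : j = k
  · rw [hjk]
  set C : ι → A := fun l => Z l u - lam * w l with hC
  set R : ι → ι → A := fun j k => Z k (C j) - Z j (C k) with hR
  obtain ⟨c, hc⟩ := h.isUnit p₀
  have hc' := c.inv_mul
  rw [hc] at hc'
  set c' : A := ↑c⁻¹
  have hZw : ∀ j k, Z k (w j) = -(if j = p₀ then c' else 0) * w k := by
    intro j k
    by_cases hj : j = p₀
    · subst hj
      rw [if_pos rfl]
      linear_combination c' * h.pole_mul_Z_w k - Z k (w j) * hc'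
    · rw [h.Z_w k j hj, if_neg hj]; ring
  have hRa : ∀ j k, R j k = (Z j lam + lam * (if j = p₀ then c' else 0)) * w k
      - (Z k lam + lam * (if k = p₀ then c' else 0)) * w j := by
    intro j k
    simp only [hR, hC, map_sub, derivation_mul]
    rw [hZw j k, hZw k j, h.comm_ZZ k j]
    ring
  have hcyc : ∀ j k m, w m * R j k + w j * R k m + w k * R m j = 0 := by
    intro j k m
    simp only [hRa]; ring
  have hWR : ∀ i j k, W i (R j k) = 0 := by
    intro i j k
    simp only [hR, map_sub, h.comm_WZ]
    rw [hW, hW]; simp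
  have hXR : ∀ a b j k, X z W a b (R j k) = 0 := fun a b j k => by
    rw [X_apply, hWR, hWR]; simp
  have hXcyc : ∀ a b j k m, R j k * X z W a b (w m) + R k m * X z W a b (w j)
      + R m j * X z W a b (w k) = 0 := by
    intro a b j k m
    have := congrArg (X z W a b) (hcyc j k m)
    simp only [map_add, derivation_mul, hXR, map_zero] at this
    linear_combination this
  suffices R j k = 0 by
    have h0 : Z k (C j) - Z j (C k) = 0 := this
    exact sub_eq_zero.1 h0
  obtain ⟨m, hmj, hmk⟩ := exists_ne_ne hcard j k
  by_cases hex : ∃ i, i ≠ j ∧ i ≠ k ∧ i ≠ m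
  · obtain ⟨i, hij, hik, him⟩ := hex
    have h1 := hXcyc m i j k m
    simp [h.X_w him.symm, hij.symm, hik.symm, hmj.symm, hmk.symm] at h1
    apply (h.isUnit i).mul_left_cancel
    linear_combination h1
  · push Not at hex
    have h1 := hXcyc m j j k m
    have h2 := hXcyc m k j k m
    simp [h.X_w hmj, hmj.symm, hmk.symm, Ne.symm hjk] at h1
    simp [h.X_w hmk, hmj.symm, hmk.symm, hjk] at h2
    have hsum : z j * w j + z k * w k + z m * w m = 1 := by
      rw [← h.sum_mul, ← Finset.sum_subset (Finset.subset_univ ({j, k, m} : Finset ι))]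
      · rw [Finset.sum_insert (by simp [hjk, hmj.symm]), Finset.sum_pair hmk.symm]; ring
      · intro i _ hi
        simp only [Finset.mem_insert, Finset.mem_singleton, not_or] at hi
        exact absurd (hex i hi.1 hi.2.1) hi.2.2
    linear_combination z m * hcyc j k m - R j k * hsum + w j * h1 + w k * h2

end IsDualFrame

/-! ### Gluing local primitives on a simply connected space -/

/-- On a simply connected, locally path connected space, a family of local functions whose
differences are locally constant comes from one global function, up to locally constant functions.
The functions that differ from the given ones by locally constant functions are the sections of a
covering space with fibre `A`, and this covering has a global section. -/
theorem exists_glue_of_locally_const {X A : Type*} [TopologicalSpace X] [AddCommGroup A]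
    [SimplyConnectedSpace X] [LocallyPathConnectedSpace X] (U : X → Set X)
    (hU : ∀ x, IsOpen (U x)) (hxU : ∀ x, x ∈ U x) (F : X → X → A)
    (hF : ∀ x y, ∀ p ∈ U x ∩ U y, ∀ᶠ q in 𝓝 p, F x q - F y q = F x p - F y p) :
    ∃ f : X → A, ∀ x, ∀ p ∈ U x, ∀ᶠ q in 𝓝 p, f q - F x q = f p - F x p := by
  let _ : TopologicalSpace A := ⊥
  have : DiscreteTopology A := ⟨rfl⟩
  let B : FiberBundleCore X X A :=
    { baseSet := U
      isOpen_baseSet := hU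
      indexAt := id
      mem_baseSet_at := hxU
      coordChange := fun i j x v => v + (F i x - F j x)
      coordChange_self := fun i x _ v => by simp
      continuousOn_coordChange := by
        rintro i j ⟨x, v⟩ ⟨hx, -⟩
        apply ContinuousAt.continuousWithinAt
        refine ContinuousAt.add continuousAt_snd ?_
        have h1 : ∀ᶠ q : X × A in 𝓝 (x, v), F i q.1 - F j q.1 = F i x - F j x :=
          (continuousAt_fst (p := (x, v))).eventually (hF i j x hx)
        exact (continuousAt_congr h1).2 continuousAt_const
      coordChange_comp := fun i j k x _ v => by
        abel }
  have hcov : IsCoveringMap B.proj := FiberBundle.isCoveringMap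
  obtain ⟨x₀⟩ : Nonempty X := inferInstance
  obtain ⟨s, ⟨-, hs⟩, -⟩ := hcov.existsUnique_continuousMap_lifts (ContinuousMap.id X) x₀
    (⟨x₀, (0 : A)⟩ : B.TotalSpace) rfl
  have hs' : ∀ x, (s x).proj = x := fun x => congrFun hs x
  let val : B.TotalSpace → A := fun e => (e.2 : A)
  refine ⟨fun x => val (s x) + F x x, fun x p hp => ?_⟩
  have hps : s p ∈ (B.localTriv x).source := by
    change (s p).proj ∈ U x
    rw [hs']; exact hp
  have hc : ContinuousAt (fun q => (B.localTriv x (s q)).2) p :=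
    ((B.localTriv x).continuousOn.continuousAt
      ((B.localTriv x).open_source.mem_nhds hps)).snd.comp (f := s) s.continuous.continuousAt
  have hval : ∀ q, (B.localTriv x (s q)).2 = val (s q) + F q q - F x q := by
    intro q
    change val (s q) + (F (s q).proj (s q).proj - F x (s q).proj) = _
    rw [hs']; abel
  have hev := hc.eventually (p := fun a => a = (B.localTriv x (s p)).2)
    ((isOpen_discrete {(B.localTriv x (s p)).2}).mem_nhds rfl)
  filter_upwards [hev] with q hq
  rw [hval, hval] at hq
  exact hq

/-! ### Calculus of smooth functions on a hypersurface -/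

theorem minSmoothness_two_le_infty : minSmoothness ℝ 2 ≤ (∞ : WithTop ℕ∞) := by
  rw [minSmoothness_of_isRCLikeNormedField]
  exact ENat.LEInfty.out

section

variable {n : ℕ} {S : Set (Cn n)} {p : Cn n} {ρ : Cn n → ℝ} {u u' : Cn n → ℂ}

theorem IsLocalDefiningFunction.contDiffAt (hρ : IsLocalDefiningFunction S p ρ) :
    ContDiffAt ℝ ∞ ρ p := by
  obtain ⟨U, hU, hpU, hs, -, -⟩ := hρ
  exact hs.contDiffAt (hU.mem_nhds hpU)

theorem IsLocalDefiningFunction.fderiv_ne_zero (hρ : IsLocalDefiningFunction S p ρ) (hp : p ∈ S) :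
    fderiv ℝ ρ p ≠ 0 := by
  obtain ⟨U, hU, hpU, -, -, hd⟩ := hρ
  exact hd p ⟨hpU, hp⟩

theorem IsSmoothFunOn.congr (hu : IsSmoothFunOn S u) (h : ∀ z ∈ S, u' z = u z) :
    IsSmoothFunOn S u' := by
  intro p hp
  obtain ⟨U, hU, hpU, v, hv, huv⟩ := hu p hp
  exact ⟨U, hU, hpU, v, hv, fun z hz => (h z hz.1).trans (huv z hz)⟩

theorem isSmoothFunOn_of_contDiff (hu : ContDiff ℝ ∞ u) : IsSmoothFunOn S u :=
  fun _ _ => ⟨Set.univ, isOpen_univ, trivial, u, hu.contDiffOn, fun _ _ => rfl⟩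

theorem isSmoothFunOn_const (c : ℂ) : IsSmoothFunOn S (fun _ => c) :=
  isSmoothFunOn_of_contDiff contDiff_const

theorem isSmoothFunOn_coord (j : Fin n) : IsSmoothFunOn S (fun z => z j) :=
  isSmoothFunOn_of_contDiff (contDiff_apply ℝ ℂ j)

theorem IsSmoothFunOn.add (hu : IsSmoothFunOn S u) (hu' : IsSmoothFunOn S u') :
    IsSmoothFunOn S (fun z => u z + u' z) := by
  intro p hp
  obtain ⟨U, hU, hpU, v, hv, huv⟩ := hu p hp
  obtain ⟨U', hU', hpU', v', hv', huv'⟩ := hu' p hp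
  refine ⟨U ∩ U', hU.inter hU', ⟨hpU, hpU'⟩, fun z => v z + v' z,
    (hv.mono Set.inter_subset_left).add (hv'.mono Set.inter_subset_right), fun z hz => ?_⟩
  simp only [huv z ⟨hz.1, hz.2.1⟩, huv' z ⟨hz.1, hz.2.2⟩]

theorem IsSmoothFunOn.mul (hu : IsSmoothFunOn S u) (hu' : IsSmoothFunOn S u') :
    IsSmoothFunOn S (fun z => u z * u' z) := by
  intro p hp
  obtain ⟨U, hU, hpU, v, hv, huv⟩ := hu p hp
  obtain ⟨U', hU', hpU', v', hv', huv'⟩ := hu' p hp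
  refine ⟨U ∩ U', hU.inter hU', ⟨hpU, hpU'⟩, fun z => v z * v' z,
    (hv.mono Set.inter_subset_left).mul (hv'.mono Set.inter_subset_right), fun z hz => ?_⟩
  simp only [huv z ⟨hz.1, hz.2.1⟩, huv' z ⟨hz.1, hz.2.2⟩]

theorem IsSmoothFunOn.inv (hu : IsSmoothFunOn S u) (h0 : ∀ z ∈ S, u z ≠ 0) :
    IsSmoothFunOn S (fun z => (u z)⁻¹) := by
  intro p hp
  obtain ⟨U, hU, hpU, v, hv, huv⟩ := hu p hp
  refine ⟨U ∩ v ⁻¹' {0}ᶜ, hv.continuousOn.isOpen_inter_preimage hU isOpen_compl_singleton,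
    ⟨hpU, ?_⟩, fun z => (v z)⁻¹, (hv.mono Set.inter_subset_left).inv fun z hz => hz.2,
    fun z hz => ?_⟩
  · rw [Set.mem_preimage, ← huv p ⟨hp, hpU⟩]; exact h0 p hp
  · simp only [huv z ⟨hz.1, hz.2.1⟩]

theorem IsSmoothFunOn.exists_extension (hu : IsSmoothFunOn S u) (hp : p ∈ S) :
    ∃ v : Cn n → ℂ, DifferentiableAt ℝ v p ∧ u =ᶠ[𝓝[S] p] v := by
  obtain ⟨U, hU, hpU, v, hv, huv⟩ := hu p hp
  refine ⟨v, (hv.contDiffAt (hU.mem_nhds hpU)).differentiableAt (by simp), ?_⟩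
  filter_upwards [self_mem_nhdsWithin, mem_nhdsWithin_of_mem_nhds (hU.mem_nhds hpU)] with z h1 h2
  exact huv z ⟨h1, h2⟩

theorem tDeriv_congr (hp : p ∈ S) (h : u =ᶠ[𝓝[S] p] u') (v : Cn n) :
    tDeriv S u p v = tDeriv S u' p v := by
  rw [tDeriv, tDeriv, h.fderivWithin_eq (h.self_of_nhdsWithin hp)]

theorem tDeriv_congr_of_eqOn (hp : p ∈ S) (h : ∀ z ∈ S, u z = u' z) (v : Cn n) :
    tDeriv S u p v = tDeriv S u' p v :=
  tDeriv_congr hp (by filter_upwards [self_mem_nhdsWithin] with z hz using h z hz) v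

theorem tDeriv_vec_add (v v' : Cn n) : tDeriv S u p (v + v') = tDeriv S u p v + tDeriv S u p v' :=
  map_add _ _ _

theorem tDeriv_vec_sub (v v' : Cn n) : tDeriv S u p (v - v') = tDeriv S u p v - tDeriv S u p v' :=
  map_sub _ _ _

theorem tDeriv_vec_neg (v : Cn n) : tDeriv S u p (-v) = -tDeriv S u p v :=
  map_neg _ _

theorem tDeriv_vec_smul (c : ℝ) (v : Cn n) : tDeriv S u p (c • v) = c * tDeriv S u p v := by
  rw [tDeriv, map_smul, Complex.real_smul]; rfl

section

variable (hS : IsSmoothHypersurface S) (hp : p ∈ S)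

include hS hp

theorem tDeriv_eq_fderiv {w : Cn n → ℂ} (hw : DifferentiableAt ℝ w p) (huw : u =ᶠ[𝓝[S] p] w)
    {v : Cn n} (hv : v ∈ tangent S p) : tDeriv S u p v = fderiv ℝ w p v := by
  obtain ⟨ρ, hρ⟩ := hS p hp
  exact tDeriv_eq hp hρ hw huw hv

theorem tDeriv_coord (j : Fin n) {v : Cn n} (hv : v ∈ tangent S p) :
    tDeriv S (fun z => z j) p v = v j := by
  have h : HasFDerivAt (fun z : Cn n => z j) (ContinuousLinearMap.proj (R := ℝ) j) p :=
    hasFDerivAt_apply j p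
  rw [tDeriv_eq_fderiv hS hp h.differentiableAt Filter.EventuallyEq.rfl hv, h.fderiv]
  rfl

theorem tDeriv_const (c : ℂ) {v : Cn n} (hv : v ∈ tangent S p) :
    tDeriv S (fun _ => c) p v = 0 := by
  rw [tDeriv_eq_fderiv hS hp (differentiableAt_const c) Filter.EventuallyEq.rfl hv]
  simp

theorem tDeriv_add (hu : IsSmoothFunOn S u) (hu' : IsSmoothFunOn S u') {v : Cn n}
    (hv : v ∈ tangent S p) :
    tDeriv S (fun z => u z + u' z) p v = tDeriv S u p v + tDeriv S u' p v := by
  obtain ⟨a, ha, hua⟩ := hu.exists_extension hp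
  obtain ⟨b, hb, hub⟩ := hu'.exists_extension hp
  rw [tDeriv_eq_fderiv hS hp ha hua hv, tDeriv_eq_fderiv hS hp hb hub hv,
    tDeriv_eq_fderiv hS hp (ha.fun_add hb) (hua.fun_add hub) hv, fderiv_fun_add ha hb]
  rfl

theorem tDeriv_mul (hu : IsSmoothFunOn S u) (hu' : IsSmoothFunOn S u') {v : Cn n}
    (hv : v ∈ tangent S p) :
    tDeriv S (fun z => u z * u' z) p v = u p * tDeriv S u' p v + u' p * tDeriv S u p v := by
  obtain ⟨a, ha, hua⟩ := hu.exists_extension hp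
  obtain ⟨b, hb, hub⟩ := hu'.exists_extension hp
  rw [tDeriv_eq_fderiv hS hp ha hua hv, tDeriv_eq_fderiv hS hp hb hub hv,
    tDeriv_eq_fderiv hS hp (ha.fun_mul hb) (hua.fun_mul hub) hv, fderiv_fun_mul ha hb,
    hua.self_of_nhdsWithin hp, hub.self_of_nhdsWithin hp]
  rfl

theorem tDeriv_sum {ι : Type*} (s : Finset ι) {f : ι → Cn n → ℂ}
    (hf : ∀ i ∈ s, IsSmoothFunOn S (f i)) {v : Cn n} (hv : v ∈ tangent S p) :
    tDeriv S (fun z => ∑ i ∈ s, f i z) p v = ∑ i ∈ s, tDeriv S (f i) p v := by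
  choose! a ha hfa using fun i hi => (hf i hi).exists_extension hp
  have h1 : (fun z => ∑ i ∈ s, f i z) =ᶠ[𝓝[S] p] fun z => ∑ i ∈ s, a i z := by
    have := (Filter.eventually_all_finset s).2 hfa
    filter_upwards [this] with z hz
    exact Finset.sum_congr rfl hz
  have h2 : HasFDerivAt (fun z => ∑ i ∈ s, a i z) (∑ i ∈ s, fderiv ℝ (a i) p) p :=
    HasFDerivAt.fun_sum fun i hi => (ha i hi).hasFDerivAt
  rw [tDeriv_eq_fderiv hS hp h2.differentiableAt h1 hv, h2.fderiv, sum_apply]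
  exact Finset.sum_congr rfl fun i hi => (tDeriv_eq_fderiv hS hp (ha i hi) (hfa i hi) hv).symm

end

/-! ### The dual coordinates on `S` -/

/-- The pairing of the Wirtinger gradient with a vector is the `(1, 0)`-part of the differential. -/
theorem sum_mul_wirtinger (ρ : Cn n → ℝ) (p v : Cn n) :
    ∑ j, v j * wirtinger ρ p j
      = (1 / 2) * ((fderiv ℝ ρ p v : ℂ) - Complex.I * (fderiv ℝ ρ p (Complex.I • v) : ℂ)) := by
  set L := fderiv ℝ ρ p
  have key : ∀ v : Cn n,
      L v = ∑ j, ((v j).re * L (Pi.single j 1) + (v j).im * L (Pi.single j Complex.I)) := by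
    intro v
    have hv : v = ∑ j, ((v j).re • (Pi.single j 1 : Cn n)
        + (v j).im • (Pi.single j Complex.I : Cn n)) := by
      ext i
      simp [Finset.sum_apply, Pi.single_apply, Finset.sum_add_distrib]
    conv_lhs => rw [hv]
    simp [map_sum]
  rw [key v, key (Complex.I • v)]
  push_cast
  rw [Finset.mul_sum, ← Finset.sum_sub_distrib, Finset.mul_sum]
  refine Finset.sum_congr rfl fun j _ => ?_
  simp [wirtinger]
  linear_combination (-(1 / 2) * (v j).im * (fderiv ℝ ρ p (Pi.single j Complex.I) : ℂ))
    * Complex.I_mul_I - (1 / 2) * ((fderiv ℝ ρ p (Pi.single j 1) : ℂ)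
      - Complex.I * (fderiv ℝ ρ p (Pi.single j Complex.I) : ℂ)) * Complex.re_add_im (v j)

theorem mem_cTangent_iff (hp : p ∈ S) (hρ : IsLocalDefiningFunction S p ρ) (v : Cn n) :
    v ∈ cTangent S p ↔ ∑ j, v j * wirtinger ρ p j = 0 := by
  have h1 : v ∈ cTangent S p ↔ v ∈ tangent S p ∧ Complex.I • v ∈ tangent S p := Iff.rfl
  rw [h1, mem_tangent_iff hp hρ, mem_tangent_iff hp hρ, sum_mul_wirtinger]
  constructor
  · rintro ⟨h, h'⟩; simp [h, h']
  · intro h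
    have h2 := congrArg Complex.re h
    have h3 := congrArg Complex.im h
    simp at h2 h3
    exact ⟨h2, h3⟩

theorem sum_mul_wirtinger_ne_zero (horigin : ComplexTangentsAvoidOrigin S) (hp : p ∈ S)
    (hρ : IsLocalDefiningFunction S p ρ) : ∑ j, p j * wirtinger ρ p j ≠ 0 := by
  intro h
  refine horigin p hp (-p) ?_ (by simp)
  rw [mem_cTangent_iff hp hρ]
  simp [h]

theorem contDiffOn_wirtinger {U : Set (Cn n)} (hU : IsOpen U) (hρ : ContDiffOn ℝ ∞ ρ U)
    (j : Fin n) : ContDiffOn ℝ ∞ (fun z => wirtinger ρ z j) U := by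
  have h1 : ContDiffOn ℝ ∞ (fderiv ℝ ρ) U := hρ.fderiv_of_isOpen hU (by simp)
  have h2 : ∀ v : Cn n, ContDiffOn ℝ ∞ (fun z => (fderiv ℝ ρ z v : ℂ)) U := fun v =>
    Complex.ofRealCLM.contDiff.comp_contDiffOn (h1.clm_apply contDiffOn_const)
  exact contDiffOn_const.mul ((h2 _).sub (contDiffOn_const.mul (h2 _)))

/-- Near a point of `S`, the dual coordinates are given by one smooth formula. -/
theorem exists_dualFormula_contDiffOn (horigin : ComplexTangentsAvoidOrigin S) (hp : p ∈ S)
    (hρ : IsLocalDefiningFunction S p ρ) :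
    ∃ U : Set (Cn n), IsOpen U ∧ p ∈ U ∧ ContDiffOn ℝ ∞ ρ U ∧
      (∀ z ∈ U, ∑ i, z i * wirtinger ρ z i ≠ 0) ∧
      (∀ j, ContDiffOn ℝ ∞ (fun z => dualFormula ρ z j) U) ∧
      ∀ z ∈ S ∩ U, IsLocalDefiningFunction S z ρ ∧ ∀ j, dualCoord S j z = dualFormula ρ z j := by
  have h0 := sum_mul_wirtinger_ne_zero horigin hp hρ
  obtain ⟨U, hU, hpU, hs, hS0, hd⟩ := hρ
  have hN : ContDiffOn ℝ ∞ (fun z : Cn n => ∑ i, z i * wirtinger ρ z i) U :=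
    ContDiffOn.sum fun i _ => (contDiff_apply ℝ ℂ i).contDiffOn.mul (contDiffOn_wirtinger hU hs i)
  refine ⟨U ∩ (fun z : Cn n => ∑ i, z i * wirtinger ρ z i) ⁻¹' {0}ᶜ,
    hN.continuousOn.isOpen_inter_preimage hU isOpen_compl_singleton, ⟨hpU, h0⟩,
    hs.mono Set.inter_subset_left, fun z hz => hz.2, fun j => ?_, fun z hz => ?_⟩
  · simp only [dualFormula, div_eq_mul_inv]
    exact ((contDiffOn_wirtinger hU hs j).mono Set.inter_subset_left).mul
      ((hN.mono Set.inter_subset_left).inv fun z hz => hz.2)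
  · have hz' : IsLocalDefiningFunction S z ρ := ⟨U, hU, hz.2.1, hs, hS0, hd⟩
    exact ⟨hz', fun j => dualCoord_eq hz.1 hz' j⟩

theorem isSmoothFunOn_dualCoord (hS : IsSmoothHypersurface S)
    (horigin : ComplexTangentsAvoidOrigin S) (j : Fin n) : IsSmoothFunOn S (dualCoord S j) := by
  intro p hp
  obtain ⟨ρ, hρ⟩ := hS p hp
  obtain ⟨U, hU, hpU, -, -, hw, hUS⟩ := exists_dualFormula_contDiffOn horigin hp hρ
  exact ⟨U, hU, hpU, _, hw j, fun z hz => (hUS z hz).2 j⟩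

theorem sum_mul_dualCoord (hS : IsSmoothHypersurface S) (horigin : ComplexTangentsAvoidOrigin S)
    (hp : p ∈ S) : ∑ j, p j * dualCoord S j p = 1 := by
  obtain ⟨ρ, hρ⟩ := hS p hp
  have h0 := sum_mul_wirtinger_ne_zero horigin hp hρ
  simp only [dualCoord_eq hp hρ, dualFormula, ← mul_div_assoc]
  rw [← Finset.sum_div, div_self h0]

theorem mem_cTangent_iff_dualCoord (hS : IsSmoothHypersurface S)
    (horigin : ComplexTangentsAvoidOrigin S) (hp : p ∈ S) (v : Cn n) :
    v ∈ cTangent S p ↔ ∑ j, v j * dualCoord S j p = 0 := by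
  obtain ⟨ρ, hρ⟩ := hS p hp
  have h0 := sum_mul_wirtinger_ne_zero horigin hp hρ
  rw [mem_cTangent_iff hp hρ]
  simp only [dualCoord_eq hp hρ, dualFormula, ← mul_div_assoc]
  rw [← Finset.sum_div, div_eq_zero_iff, or_iff_left h0]

/-- The differential of the identity `∑ z_j w_j = 1`. -/
theorem sum_mul_tDeriv_dualCoord (hS : IsSmoothHypersurface S)
    (horigin : ComplexTangentsAvoidOrigin S) (hp : p ∈ S) {v : Cn n} (hv : v ∈ tangent S p) :
    ∑ j, p j * tDeriv S (dualCoord S j) p v + ∑ j, v j * dualCoord S j p = 0 := by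
  have hw := isSmoothFunOn_dualCoord hS horigin
  have h1 : tDeriv S (fun z => ∑ j, z j * dualCoord S j z) p v = 0 := by
    rw [tDeriv_congr_of_eqOn hp (fun z hz => sum_mul_dualCoord hS horigin hz) v,
      tDeriv_const hS hp 1 hv]
  rw [tDeriv_sum hS hp _ (fun j _ => (isSmoothFunOn_coord j).mul (hw j)) hv] at h1
  rw [← h1, ← Finset.sum_add_distrib]
  refine Finset.sum_congr rfl fun j _ => ?_
  rw [tDeriv_mul hS hp (isSmoothFunOn_coord j) (hw j) hv, tDeriv_coord hS hp j hv]
  ring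

/-- On the maximal complex subspace, the differentials of the dual coordinates are given by the
Hessian of a defining function. -/
theorem sum_mul_tDeriv_dualCoord_eq_hessian (hS : IsSmoothHypersurface S)
    (horigin : ComplexTangentsAvoidOrigin S) (hp : p ∈ S) (hρ : IsLocalDefiningFunction S p ρ)
    {b v : Cn n} (hb : b ∈ cTangent S p) (hv : v ∈ tangent S p) :
    ∑ j, b j * tDeriv S (dualCoord S j) p v
      = ((fderiv ℝ (fderiv ℝ ρ) p v b : ℂ)
          - Complex.I * (fderiv ℝ (fderiv ℝ ρ) p v (Complex.I • b) : ℂ))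
        / (2 * ∑ i, p i * wirtinger ρ p i) := by
  obtain ⟨U, hU, hpU, hs, hN, hw, hUS⟩ := exists_dualFormula_contDiffOn horigin hp hρ
  have hUn := hU.mem_nhds hpU
  set N : Cn n → ℂ := fun z => ∑ i, z i * wirtinger ρ z i with hNdef
  have hNd : DifferentiableAt ℝ N p := by
    have : ContDiffOn ℝ ∞ N U := ContDiffOn.sum fun i _ =>
      (contDiff_apply ℝ ℂ i).contDiffOn.mul (contDiffOn_wirtinger hU hs i)
    exact (this.contDiffAt hUn).differentiableAt (by simp)
  have hwd : ∀ j, DifferentiableAt ℝ (fun z => dualFormula ρ z j) p := fun j =>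
    ((hw j).contDiffAt hUn).differentiableAt (by simp)
  have hH : DifferentiableAt ℝ (fderiv ℝ ρ) p :=
    ((hs.fderiv_of_isOpen hU (m := ∞) (by simp)).contDiffAt hUn).differentiableAt (by simp)
  have hHa : ∀ c : Cn n, HasFDerivAt (fun z => ((fderiv ℝ ρ z c : ℝ) : ℂ))
      (Complex.ofRealCLM.comp ((fderiv ℝ (fderiv ℝ ρ) p).flip c)) p := by
    intro c
    have h1 : HasFDerivAt (fun z => fderiv ℝ ρ z c) ((fderiv ℝ (fderiv ℝ ρ) p).flip c) p := by
      simpa using hH.hasFDerivAt.clm_apply (hasFDerivAt_const c p)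
    exact Complex.ofRealCLM.hasFDerivAt.comp p h1
  set g : Cn n → ℂ := fun z => (1 / 2) * ((fderiv ℝ ρ z b : ℂ)
    - Complex.I * (fderiv ℝ ρ z (Complex.I • b) : ℂ)) with hg
  have hgd := ((hHa b).sub ((hHa (Complex.I • b)).const_mul Complex.I)).const_mul (1 / 2 : ℂ)
  have hg0 : g p = 0 := by
    rw [hg]; simp only
    rw [← sum_mul_wirtinger]
    exact (mem_cTangent_iff hp hρ b).1 hb
  have hprod : ∀ z ∈ U, N z * ∑ j, b j * dualFormula ρ z j = g z := by
    intro z hz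
    have : ∑ j, b j * dualFormula ρ z j = (∑ j, b j * wirtinger ρ z j) / N z := by
      simp only [dualFormula, ← mul_div_assoc]
      rw [Finset.sum_div]
    rw [this, mul_div_cancel₀ _ (hN z hz), sum_mul_wirtinger]
  have hsum : HasFDerivAt (fun z => ∑ j, b j * dualFormula ρ z j)
      (∑ j, b j • fderiv ℝ (fun z => dualFormula ρ z j) p) p :=
    HasFDerivAt.fun_sum fun j _ => ((hwd j).hasFDerivAt).const_mul (b j)
  have h1 : HasFDerivAt g _ p := ((hNd.hasFDerivAt.mul hsum).congr_of_eventuallyEq (by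
    filter_upwards [hUn] with z hz using (hprod z hz).symm))
  have h2 := DFunLike.congr_fun (h1.unique hgd) v
  have hz0 : ∑ j, b j * dualFormula ρ p j = 0 := by
    have := hprod p hpU
    rw [hg0] at this
    exact (mul_eq_zero.1 this).resolve_left (hN p hpU)
  have hT : ∀ j, tDeriv S (dualCoord S j) p v = fderiv ℝ (fun z => dualFormula ρ z j) p v := by
    intro j
    refine tDeriv_eq_fderiv hS hp (hwd j) ?_ hv
    filter_upwards [self_mem_nhdsWithin, mem_nhdsWithin_of_mem_nhds hUn] with z hz hz'
    exact (hUS z ⟨hz, hz'⟩).2 j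
  simp only [hT]
  rw [eq_div_iff (mul_ne_zero two_ne_zero (hN p hpU))]
  simp [hz0] at h2
  linear_combination 2 * h2

end

/-! ### Projective invariance of the Hessian on complex tangent vectors -/

section

variable {n : ℕ} {M : Matrix (Fin (n + 1)) (Fin (n + 1)) ℂ}

/-- Homogeneous coordinates of the image of `z` under the projective transformation `M`. -/
def homog (M : Matrix (Fin (n + 1)) (Fin (n + 1)) ℂ) (z : Cn n) : Fin (n + 1) → ℂ :=
  M.mulVec (Matrix.vecCons 1 z)

/-- The linear part of the affine map `homog M`. -/
def homogLin (M : Matrix (Fin (n + 1)) (Fin (n + 1)) ℂ) : Cn n →L[ℂ] (Fin (n + 1) → ℂ) :=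
  LinearMap.toContinuousLinearMap
    { toFun := fun v => M.mulVec (Matrix.vecCons 0 v)
      map_add' := fun v w => by
        rw [← Matrix.mulVec_add, Matrix.cons_add_cons, add_zero]
      map_smul' := fun c v => by
        rw [RingHom.id_apply, ← Matrix.mulVec_smul, Matrix.smul_cons, smul_zero] }

theorem homogLin_apply (v : Cn n) : homogLin M v = M.mulVec (Matrix.vecCons 0 v) := rfl

theorem homog_eq (z : Cn n) : homog M z = homog M 0 + homogLin M z := by
  rw [homogLin_apply, homog, homog, ← Matrix.mulVec_add, Matrix.cons_add_cons, add_zero, zero_add]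

theorem hasFDerivAt_homog (z : Cn n) (i : Fin (n + 1)) :
    HasFDerivAt (fun z => homog M z i)
      ((ContinuousLinearMap.proj (R := ℝ) i).comp ((homogLin M).restrictScalars ℝ)) z := by
  have h : (fun z => homog M z i) = fun z => homog M 0 i + homogLin M z i := by
    funext z; rw [homog_eq]; rfl
  rw [h]
  exact (((ContinuousLinearMap.proj (R := ℝ) i).comp
    ((homogLin M).restrictScalars ℝ)).hasFDerivAt).const_add _

theorem contDiff_homog (i : Fin (n + 1)) : ContDiff ℝ ∞ (fun z : Cn n => homog M z i) := by
  have h : (fun z => homog M z i) = fun z => homog M 0 i + homogLin M z i := by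
    funext z; rw [homog_eq]; rfl
  rw [h]
  exact contDiff_const.add (((ContinuousLinearMap.proj (R := ℝ) i).comp
    ((homogLin M).restrictScalars ℝ)).contDiff)

theorem projDenom_mul_projMap {z : Cn n} (hz : projDenom M z ≠ 0) (j : Fin n) :
    projDenom M z * projMap M z j = homog M z j.succ :=
  mul_div_cancel₀ _ hz

theorem eq_of_smul_homog (hM : M.det ≠ 0) {a b : ℂ} {x y : Fin (n + 1) → ℂ}
    (h : a • M.mulVec x = b • M.mulVec y) : a • x = b • y := by
  have hinj : Function.Injective M.mulVec :=
    Matrix.mulVec_injective_iff_isUnit.2 ((Matrix.isUnit_iff_isUnit_det _).2 hM.isUnit)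
  exact hinj (by rw [Matrix.mulVec_smul, Matrix.mulVec_smul, h])

theorem projMap_injOn (hM : M.det ≠ 0) {z z' : Cn n} (hz : projDenom M z ≠ 0)
    (hz' : projDenom M z' ≠ 0) (h : projMap M z = projMap M z') : z = z' := by
  have h1 : projDenom M z' • homog M z = projDenom M z • homog M z' := by
    ext i
    refine Fin.cases ?_ (fun j => ?_) i
    · exact mul_comm _ _
    · simp only [Pi.smul_apply, smul_eq_mul]
      rw [← projDenom_mul_projMap hz, ← projDenom_mul_projMap hz', h]; ring
  have h2 := eq_of_smul_homog hM h1
  have h0 : projDenom M z' = projDenom M z := by simpa using congrFun h2 0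
  ext j
  have h3 := congrFun h2 j.succ
  simp only [Pi.smul_apply, Matrix.cons_val_succ, smul_eq_mul, h0] at h3
  exact mul_left_cancel₀ hz h3

theorem contDiffOn_projMap {U : Set (Cn n)} (hU : ∀ z ∈ U, projDenom M z ≠ 0) :
    ContDiffOn ℝ ∞ (projMap M) U := by
  refine contDiffOn_pi.2 fun j => ?_
  have : (fun z => projMap M z j) = fun z => homog M z j.succ * (homog M z 0)⁻¹ := by
    funext z; exact div_eq_mul_inv _ _
  rw [this]
  exact (contDiff_homog _).contDiffOn.mul ((contDiff_homog 0).contDiffOn.inv hU)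

theorem projMap_fderiv_apply {z : Cn n} {U : Set (Cn n)} (hUo : IsOpen U)
    (hU : ∀ z ∈ U, projDenom M z ≠ 0) (hz : z ∈ U) (v : Cn n) (j : Fin n) :
    projDenom M z * fderiv ℝ (projMap M) z v j
      = homogLin M v j.succ - homogLin M v 0 * projMap M z j := by
  have hd : DifferentiableAt ℝ (projMap M) z :=
    ((contDiffOn_projMap hU).contDiffAt (hUo.mem_nhds hz)).differentiableAt (by simp)
  have h1 : HasFDerivAt (fun z => homog M z 0 * projMap M z j) _ z :=
    (hasFDerivAt_homog z 0).mul (hasFDerivAt_pi'.1 hd.hasFDerivAt j)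
  have h2 : HasFDerivAt (fun z => homog M z 0 * projMap M z j) _ z :=
    (hasFDerivAt_homog z j.succ).congr_of_eventuallyEq (by
      filter_upwards [hUo.mem_nhds hz] with x hx using projDenom_mul_projMap (hU x hx) j)
  have h3 := DFunLike.congr_fun (h1.unique h2) v
  have e : homog M z 0 = projDenom M z := rfl
  simp [e] at h3
  linear_combination h3

theorem projMap_fderiv_I_smul {z : Cn n} {U : Set (Cn n)} (hUo : IsOpen U)
    (hU : ∀ z ∈ U, projDenom M z ≠ 0) (hz : z ∈ U) (v : Cn n) :
    fderiv ℝ (projMap M) z (Complex.I • v) = Complex.I • fderiv ℝ (projMap M) z v := by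
  ext j
  apply mul_left_cancel₀ (hU z hz)
  rw [projMap_fderiv_apply hUo hU hz, Pi.smul_apply, smul_eq_mul, mul_left_comm,
    projMap_fderiv_apply hUo hU hz, map_smul]
  simp only [Pi.smul_apply, smul_eq_mul]
  ring

theorem projMap_fderiv_injective (hM : M.det ≠ 0) {z : Cn n} {U : Set (Cn n)} (hUo : IsOpen U)
    (hU : ∀ z ∈ U, projDenom M z ≠ 0) (hz : z ∈ U) :
    Function.Injective (fderiv ℝ (projMap M) z) := by
  rw [injective_iff_map_eq_zero]
  intro v hv
  have h1 : projDenom M z • M.mulVec (Matrix.vecCons 0 v)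
      = homogLin M v 0 • M.mulVec (Matrix.vecCons 1 z) := by
    ext i
    refine Fin.cases (mul_comm _ _) (fun j => ?_) i
    have h2 := projMap_fderiv_apply hUo hU hz v j
    rw [hv] at h2
    have h3 := projDenom_mul_projMap (hU z hz) j
    simp only [Pi.smul_apply, smul_eq_mul]
    change projDenom M z * homogLin M v j.succ = homogLin M v 0 * homog M z j.succ
    rw [← h3]
    simp only [Pi.zero_apply, mul_zero] at h2
    linear_combination (-projDenom M z) * h2
  have h2 := eq_of_smul_homog hM h1
  have h0 : homogLin M v 0 = 0 := by simpa using (congrFun h2 0).symm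
  ext j
  have h3 := congrFun h2 j.succ
  simp only [h0, Pi.smul_apply, Matrix.cons_val_succ, smul_eq_mul, zero_mul] at h3
  exact (mul_eq_zero.1 h3).resolve_left (hU z hz)

/-- The second derivative of a projective map along `v` is a complex multiple of its first
derivative along `v`, because projective maps send complex lines to complex lines. -/
theorem projMap_fderiv_fderiv {z : Cn n} {U : Set (Cn n)} (hUo : IsOpen U)
    (hU : ∀ z ∈ U, projDenom M z ≠ 0) (hz : z ∈ U) (v : Cn n) :
    ∃ c : ℂ, fderiv ℝ (fun x => fderiv ℝ (projMap M) x v) z v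
      = c • fderiv ℝ (projMap M) z v := by
  have hs := (contDiffOn_projMap hU)
  have hd : DifferentiableAt ℝ (projMap M) z :=
    (hs.contDiffAt (hUo.mem_nhds hz)).differentiableAt (by simp)
  have hs' : ContDiffOn ℝ ∞ (fun x => fderiv ℝ (projMap M) x v) U :=
    (hs.fderiv_of_isOpen hUo (by simp)).clm_apply contDiffOn_const
  have hd' : DifferentiableAt ℝ (fun x => fderiv ℝ (projMap M) x v) z :=
    (hs'.contDiffAt (hUo.mem_nhds hz)).differentiableAt (by simp)
  refine ⟨-2 * homogLin M v 0 / projDenom M z, ?_⟩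
  ext j
  have h1 : HasFDerivAt (fun z => homog M z 0 * fderiv ℝ (projMap M) z v j) _ z :=
    (hasFDerivAt_homog z 0).mul (hasFDerivAt_pi'.1 hd'.hasFDerivAt j)
  have h2 : HasFDerivAt (fun z => homog M z 0 * fderiv ℝ (projMap M) z v j) _ z :=
    (((hasFDerivAt_pi'.1 hd.hasFDerivAt j).const_mul (homogLin M v 0)).const_sub
      (homogLin M v j.succ)).congr_of_eventuallyEq (by
      filter_upwards [hUo.mem_nhds hz] with x hx using projMap_fderiv_apply hUo hU hx v j)
  have h3 := DFunLike.congr_fun (h1.unique h2) v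
  have e : homog M z 0 = projDenom M z := rfl
  simp [e] at h3
  have h0 := hU z hz
  rw [Pi.smul_apply, smul_eq_mul]
  field_simp
  linear_combination h3

end

/-- Near each point, `S` has a defining function whose real Hessian is positive on the maximal
complex subspace of the tangent space. -/
def HasPositiveHessian {n : ℕ} (S : Set (Cn n)) : Prop :=
  ∀ p ∈ S, ∃ ρ : Cn n → ℝ, IsLocalDefiningFunction S p ρ ∧
    ∀ v ∈ cTangent S p, v ≠ 0 → 0 < fderiv ℝ (fderiv ℝ ρ) p v v

/-- The pull-back of a strongly convex defining function by the projective map.  Its Hessian along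
a complex tangent vector differs from that of the convex function by the derivative of the latter
along a complex tangent vector, which vanishes. -/
theorem IsStronglyCConvex.hasPositiveHessian {n : ℕ} {S : Set (Cn n)} (hS : IsStronglyCConvex S) :
    HasPositiveHessian S := by
  intro p hp
  obtain ⟨U, hU, hpU, M, hM, hden, hconv⟩ := hS.2 p hp
  set F := projMap M with hF
  obtain ⟨ρ, hρ, hpos⟩ := hconv (F p) ⟨p, ⟨hp, hpU⟩, rfl⟩
  obtain ⟨U₁, hU₁, hpU₁, hρs, hρ0, hρd⟩ := hρ
  have hFs : ContDiffOn ℝ ∞ F U := contDiffOn_projMap hden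
  set V := U ∩ F ⁻¹' U₁ with hV
  have hVo : IsOpen V := hFs.continuousOn.isOpen_inter_preimage hU hU₁
  have hpV : p ∈ V := ⟨hpU, hpU₁⟩
  have hFd : ∀ z ∈ V, DifferentiableAt ℝ F z := fun z hz =>
    (hFs.contDiffAt (hU.mem_nhds hz.1)).differentiableAt (by simp)
  have hρdiff : ∀ z ∈ V, DifferentiableAt ℝ ρ (F z) := fun z hz =>
    (hρs.contDiffAt (hU₁.mem_nhds hz.2)).differentiableAt (by simp)
  have hder : ∀ z ∈ V, fderiv ℝ (ρ ∘ F) z = (fderiv ℝ ρ (F z)).comp (fderiv ℝ F z) := fun z hz =>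
    fderiv_comp z (hρdiff z hz) (hFd z hz)
  have hdef : IsLocalDefiningFunction S p (ρ ∘ F) := by
    refine ⟨V, hVo, hpV, hρs.comp (hFs.mono Set.inter_subset_left) fun z hz => hz.2,
      fun z hz => ?_, fun z hz => ?_⟩
    · rw [Function.comp_apply, ← hρ0 _ hz.2]
      constructor
      · exact fun h => ⟨z, ⟨h, hz.1⟩, rfl⟩
      · rintro ⟨z', hz', h⟩
        rw [← projMap_injOn hM (hden z' hz'.2) (hden z hz.1) h]; exact hz'.1
    · rw [hder z hz.1]
      intro h
      have hinj := projMap_fderiv_injective hM hU hden hz.1.1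
      have hsurj : Function.Surjective (fderiv ℝ F z) :=
        (LinearMap.injective_iff_surjective (f := (fderiv ℝ F z).toLinearMap)).1 hinj
      refine hρd (F z) ⟨hz.1.2, z, ⟨hz.2, hz.1.1⟩, rfl⟩ ?_
      ext w
      obtain ⟨v, rfl⟩ := hsurj w
      exact DFunLike.congr_fun h v
  refine ⟨ρ ∘ F, hdef, fun v hv hv0 => ?_⟩
  have hv1 : fderiv ℝ ρ (F p) (fderiv ℝ F p v) = 0 := by
    have := (mem_tangent_iff hp hdef v).1 hv.1
    rwa [hder p hpV] at this
  have hv2 : fderiv ℝ ρ (F p) (Complex.I • fderiv ℝ F p v) = 0 := by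
    have := (mem_tangent_iff hp hdef _).1 hv.2
    rw [hder p hpV] at this
    rw [← projMap_fderiv_I_smul hU hden hpU]
    exact this
  have hv3 : ∀ c : ℂ, fderiv ℝ ρ (F p) (c • fderiv ℝ F p v) = 0 := by
    intro c
    have : c • fderiv ℝ F p v
        = c.re • fderiv ℝ F p v + c.im • (Complex.I • fderiv ℝ F p v) := by
      ext i
      simp only [Pi.smul_apply, Pi.add_apply, smul_eq_mul, Complex.real_smul]
      linear_combination (-fderiv ℝ F p v i) * Complex.re_add_im c
    rw [this, map_add, map_smul, map_smul, hv1, hv2, smul_zero, smul_zero, add_zero]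
  have hne : fderiv ℝ F p v ≠ 0 := by
    intro h
    exact hv0 (projMap_fderiv_injective hM hU hden hpU (by rw [map_zero]; exact h))
  have hρ2 : DifferentiableAt ℝ (fderiv ℝ ρ) (F p) :=
    ((hρs.fderiv_of_isOpen hU₁ (m := ∞) (by simp)).contDiffAt
      (hU₁.mem_nhds hpU₁)).differentiableAt (by simp)
  have hF2 : DifferentiableAt ℝ (fun x => fderiv ℝ F x v) p :=
    (((hFs.fderiv_of_isOpen hU (m := ∞) (by simp)).clm_apply contDiffOn_const).contDiffAt
      (hU.mem_nhds hpU)).differentiableAt (by simp)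
  have hσ2 : DifferentiableAt ℝ (fderiv ℝ (ρ ∘ F)) p := by
    obtain ⟨V', hV', hpV', hs, -, -⟩ := hdef
    exact ((hs.fderiv_of_isOpen hV' (m := ∞) (by simp)).contDiffAt
      (hV'.mem_nhds hpV')).differentiableAt (by simp)
  have h1 : HasFDerivAt (fun x => fderiv ℝ (ρ ∘ F) x v) _ p :=
    hσ2.hasFDerivAt.clm_apply (hasFDerivAt_const v p)
  have h2 : HasFDerivAt (fun x => fderiv ℝ (ρ ∘ F) x v) _ p :=
    ((hρ2.hasFDerivAt.comp p (hFd p hpV).hasFDerivAt).clm_apply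
      hF2.hasFDerivAt).congr_of_eventuallyEq (by
        filter_upwards [hVo.mem_nhds hpV] with x hx
        rw [hder x hx]; rfl)
  have h3 := DFunLike.congr_fun (h1.unique h2) v
  obtain ⟨c, hc⟩ := projMap_fderiv_fderiv hU hden hpU v
  rw [← hF] at hc
  simp [hc, hv3] at h3
  rw [h3]
  exact hpos _ hne hv1

/-! ### The coframe `dz_j`, `dw_j` -/

section

variable {n : ℕ} {S : Set (Cn n)} {p : Cn n}

theorem I_smul_mem_cTangent {v : Cn n} (hv : v ∈ cTangent S p) :
    Complex.I • v ∈ cTangent S p :=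
  Submodule.smul_mem _ _ hv

variable (hS : IsSmoothHypersurface S) (horigin : ComplexTangentsAvoidOrigin S)
  (hH : HasPositiveHessian S) (hp : p ∈ S)

include hS horigin hH hp

/-- The differentials of the dual coordinates separate the complex tangent vectors.  This is where
the full Hessian, not only its Hermitian part, is used. -/
theorem eq_zero_of_tDeriv_dualCoord_eq_zero {v : Cn n} (hv : v ∈ cTangent S p)
    (h : ∀ j, tDeriv S (dualCoord S j) p v = 0) : v = 0 := by
  obtain ⟨ρ, hρ, hpos⟩ := hH p hp
  by_contra hne
  have h1 := sum_mul_tDeriv_dualCoord_eq_hessian hS horigin hp hρ hv hv.1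
  simp only [h, mul_zero, Finset.sum_const_zero] at h1
  have hN := sum_mul_wirtinger_ne_zero horigin hp hρ
  rw [eq_comm, div_eq_zero_iff, or_iff_left (mul_ne_zero two_ne_zero hN)] at h1
  have h2 := congrArg Complex.re h1
  simp at h2
  exact (hpos v hv hne).ne' h2

/-- The two complex structures are transverse: the dual coordinates are complex linear in no
nonzero direction, because the Levi form is positive. -/
theorem eq_zero_of_tDeriv_dualCoord_I_smul {b : Cn n} (hb : b ∈ cTangent S p)
    (h : ∀ j, tDeriv S (dualCoord S j) p (Complex.I • b)
      = Complex.I * tDeriv S (dualCoord S j) p b) : b = 0 := by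
  obtain ⟨ρ, hρ, hpos⟩ := hH p hp
  by_contra hne
  have hIb := I_smul_mem_cTangent hb
  have h1 := sum_mul_tDeriv_dualCoord_eq_hessian hS horigin hp hρ hb hb.1
  have h2 := sum_mul_tDeriv_dualCoord_eq_hessian hS horigin hp hρ hb hIb.1
  have h3 : ∑ j, b j * tDeriv S (dualCoord S j) p (Complex.I • b)
      = Complex.I * ∑ j, b j * tDeriv S (dualCoord S j) p b := by
    rw [Finset.mul_sum]
    exact Finset.sum_congr rfl fun j _ => by rw [h]; ring
  have hN := mul_ne_zero (two_ne_zero (α := ℂ)) (sum_mul_wirtinger_ne_zero horigin hp hρ)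
  rw [h1, h2, ← mul_div_assoc, div_left_inj' hN] at h3
  have hsymm : fderiv ℝ (fderiv ℝ ρ) p (Complex.I • b) b
      = fderiv ℝ (fderiv ℝ ρ) p b (Complex.I • b) :=
    (hρ.contDiffAt.isSymmSndFDerivAt minSmoothness_two_le_infty) _ _
  have h4 := congrArg Complex.im h3
  simp [hsymm] at h4
  have h5 := hpos b hb hne
  have h6 := hpos _ hIb (smul_ne_zero Complex.I_ne_zero hne)
  linarith

/-- A complex tangent vector `a + i b` that is annihilated by all `dz_j` and all `dw_j` is zero. -/
theorem eq_zero_of_dz_dw_eq_zero {a b : Cn n} (ha : a ∈ tangent S p) (hb : b ∈ tangent S p)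
    (hz : ∀ j, a j + Complex.I * b j = 0)
    (hw : ∀ j, tDeriv S (dualCoord S j) p a + Complex.I * tDeriv S (dualCoord S j) p b = 0) :
    a = 0 ∧ b = 0 := by
  have hab : a = -(Complex.I • b) := by
    ext j
    simp only [Pi.neg_apply, Pi.smul_apply, smul_eq_mul]
    linear_combination hz j
  have hIb : Complex.I • b ∈ tangent S p := by
    have := neg_mem ha
    rwa [hab, neg_neg] at this
  have hbH : b ∈ cTangent S p := ⟨hb, hIb⟩
  have hb0 : b = 0 := by
    refine eq_zero_of_tDeriv_dualCoord_I_smul hS horigin hH hp hbH fun j => ?_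
    have := hw j
    rw [hab, tDeriv_vec_neg] at this
    linear_combination -this
  exact ⟨by rw [hab, hb0, smul_zero, neg_zero], hb0⟩

omit hH in
theorem pole_dw_eq_zero {p₀ : Fin n} (hp₀ : p p₀ ≠ 0) {a b : Cn n} (ha : a ∈ tangent S p)
    (hb : b ∈ tangent S p) (hz : ∀ j, a j + Complex.I * b j = 0)
    (hw : ∀ j, j ≠ p₀ →
      tDeriv S (dualCoord S j) p a + Complex.I * tDeriv S (dualCoord S j) p b = 0) :
    tDeriv S (dualCoord S p₀) p a + Complex.I * tDeriv S (dualCoord S p₀) p b = 0 := by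
  have h1 := sum_mul_tDeriv_dualCoord hS horigin hp ha
  have h2 := sum_mul_tDeriv_dualCoord hS horigin hp hb
  have h3 : ∑ j, p j * (tDeriv S (dualCoord S j) p a + Complex.I * tDeriv S (dualCoord S j) p b)
      + ∑ j, (a j + Complex.I * b j) * dualCoord S j p = 0 := by
    have : ∑ j, p j * (tDeriv S (dualCoord S j) p a + Complex.I * tDeriv S (dualCoord S j) p b)
        + ∑ j, (a j + Complex.I * b j) * dualCoord S j p
        = (∑ j, p j * tDeriv S (dualCoord S j) p a + ∑ j, a j * dualCoord S j p)
          + Complex.I * (∑ j, p j * tDeriv S (dualCoord S j) p b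
            + ∑ j, b j * dualCoord S j p) := by
      simp only [Finset.mul_sum, mul_add, ← Finset.sum_add_distrib]
      exact Finset.sum_congr rfl fun j _ => by ring
    rw [this, h1, h2]; ring
  simp only [hz, zero_mul, Finset.sum_const_zero, add_zero] at h3
  rw [Finset.sum_eq_single p₀ (fun j _ hj => by rw [hw j hj, mul_zero]) (by simp)] at h3
  exact (mul_eq_zero.1 h3).resolve_left hp₀

/-- Complex tangent vectors with prescribed values of `dz_j` and `dw_j`; the only constraint is the
one that comes from `∑ z_j w_j = 1`. -/
theorem exists_tangent_dz_dw_eq {p₀ : Fin n} (hp₀ : p p₀ ≠ 0) (A B : Fin n → ℂ)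
    (hAB : ∑ j, (p j * B j + A j * dualCoord S j p) = 0) :
    ∃ a ∈ tangent S p, ∃ b ∈ tangent S p, (∀ j, a j + Complex.I * b j = A j) ∧
      ∀ j, tDeriv S (dualCoord S j) p a + Complex.I * tDeriv S (dualCoord S j) p b = B j := by
  obtain ⟨ρ, hρ, -⟩ := hH p hp
  obtain ⟨U, hU, hpU, hs, hN, hw, hUS⟩ := exists_dualFormula_contDiffOn horigin hp hρ
  have hUn := hU.mem_nhds hpU
  let y : Fin n → (Cn n →L[ℝ] ℂ) := fun j =>
    if j = p₀ then Complex.ofRealCLM.comp (fderiv ℝ ρ p)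
    else fderiv ℝ (fun z => dualFormula ρ z j) p
  have hy₀ : ∀ v, y p₀ v = (fderiv ℝ ρ p v : ℂ) := fun v => by simp [y]
  have hy : ∀ j, j ≠ p₀ → ∀ v ∈ tangent S p, y j v = tDeriv S (dualCoord S j) p v := by
    intro j hj v hv
    simp only [y, if_neg hj]
    refine (tDeriv_eq_fderiv hS hp (((hw j).contDiffAt hUn).differentiableAt (by simp)) ?_ hv).symm
    filter_upwards [self_mem_nhdsWithin, mem_nhdsWithin_of_mem_nhds hUn] with z hz hz'
    exact (hUS z ⟨hz, hz'⟩).2 j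
  have htan : ∀ a b : Cn n, y p₀ a + Complex.I * y p₀ b = 0 →
      a ∈ tangent S p ∧ b ∈ tangent S p := by
    intro a b h
    rw [hy₀, hy₀] at h
    rw [mem_tangent_iff hp hρ, mem_tangent_iff hp hρ]
    have h2 := congrArg Complex.re h
    have h3 := congrArg Complex.im h
    simp at h2 h3
    exact ⟨h2, h3⟩
  let L : (Cn n × Cn n) →ₗ[ℝ] (Cn n × Cn n) :=
    { toFun := fun x => (fun j => x.1 j + Complex.I * x.2 j,
        fun j => y j x.1 + Complex.I * y j x.2)
      map_add' := fun x x' => by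
        ext j
        · simp only [Prod.fst_add, Prod.snd_add, Pi.add_apply]; ring
        · simp only [Prod.fst_add, Prod.snd_add, Pi.add_apply, map_add]; ring
      map_smul' := fun c x => by
        ext j
        · simp only [Prod.smul_fst, Prod.smul_snd, Pi.smul_apply, Complex.real_smul,
            RingHom.id_apply]; ring
        · simp only [Prod.smul_fst, Prod.smul_snd, Pi.smul_apply, Complex.real_smul,
            RingHom.id_apply, map_smul]; ring }
  have hLinj : Function.Injective L := by
    rw [injective_iff_map_eq_zero]
    rintro ⟨a, b⟩ h
    have h1 : ∀ j, a j + Complex.I * b j = 0 := fun j => congrFun (congrArg Prod.fst h) j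
    have h2 : ∀ j, y j a + Complex.I * y j b = 0 := fun j => congrFun (congrArg Prod.snd h) j
    obtain ⟨ha, hb⟩ := htan a b (h2 p₀)
    have h3 : ∀ j, j ≠ p₀ →
        tDeriv S (dualCoord S j) p a + Complex.I * tDeriv S (dualCoord S j) p b = 0 := by
      intro j hj
      rw [← hy j hj a ha, ← hy j hj b hb, h2]
    have h4 := pole_dw_eq_zero hS horigin hp hp₀ ha hb h1 h3
    have := eq_zero_of_dz_dw_eq_zero hS horigin hH hp ha hb h1 fun j => by
      by_cases hj : j = p₀
      · rw [hj, h4]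
      · exact h3 j hj
    rw [this.1, this.2]; rfl
  obtain ⟨⟨a, b⟩, hab⟩ := (LinearMap.injective_iff_surjective (f := L)).1 hLinj
    (A, fun j => if j = p₀ then 0 else B j)
  have h1 : ∀ j, a j + Complex.I * b j = A j := fun j => congrFun (congrArg Prod.fst hab) j
  have h2 : ∀ j, y j a + Complex.I * y j b = if j = p₀ then 0 else B j :=
    fun j => congrFun (congrArg Prod.snd hab) j
  obtain ⟨ha, hb⟩ := htan a b (by rw [h2, if_pos rfl])
  have h3 : ∀ j, j ≠ p₀ →
      tDeriv S (dualCoord S j) p a + Complex.I * tDeriv S (dualCoord S j) p b = B j := by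
    intro j hj
    rw [← hy j hj a ha, ← hy j hj b hb, h2, if_neg hj]
  refine ⟨a, ha, b, hb, h1, fun j => ?_⟩
  by_cases hj : j = p₀
  · subst hj
    have e1 := sum_mul_tDeriv_dualCoord hS horigin hp ha
    have e2 := sum_mul_tDeriv_dualCoord hS horigin hp hb
    have e3 : ∑ i, p i * (tDeriv S (dualCoord S i) p a
        + Complex.I * tDeriv S (dualCoord S i) p b - B i) = 0 := by
      have : ∑ i, p i * (tDeriv S (dualCoord S i) p a
          + Complex.I * tDeriv S (dualCoord S i) p b - B i)
          = (∑ i, p i * tDeriv S (dualCoord S i) p a + ∑ i, a i * dualCoord S i p)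
            + Complex.I * (∑ i, p i * tDeriv S (dualCoord S i) p b
              + ∑ i, b i * dualCoord S i p)
            - ∑ i, (p i * B i + A i * dualCoord S i p) := by
        simp only [Finset.mul_sum, mul_add, ← Finset.sum_add_distrib, ← Finset.sum_sub_distrib]
        exact Finset.sum_congr rfl fun i _ => by rw [← h1 i]; ring
      rw [this, e1, e2, hAB]; ring
    rw [Finset.sum_eq_single j (fun i _ hi => by rw [h3 i hi, sub_self, mul_zero]) (by simp)] at e3
    exact sub_eq_zero.1 ((mul_eq_zero.1 e3).resolve_left hp₀)
  · exact h3 j hj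

/-- The forms `dz_j`, and `dw_j` for `j ≠ p₀`, are linearly independent on `T_p S`. -/
theorem coeff_eq_zero {p₀ : Fin n} (hp₀ : p p₀ ≠ 0) {α β : Fin n → ℂ} (hβ : β p₀ = 0)
    (h : ∀ v ∈ tangent S p,
      ∑ j, α j * v j + ∑ j, β j * tDeriv S (dualCoord S j) p v = 0) : α = 0 ∧ β = 0 := by
  have key : ∀ A B : Fin n → ℂ, ∑ j, (p j * B j + A j * dualCoord S j p) = 0 →
      ∑ j, α j * A j + ∑ j, β j * B j = 0 := by
    intro A B hAB
    obtain ⟨a, ha, b, hb, h1, h2⟩ := exists_tangent_dz_dw_eq hS horigin hH hp hp₀ A B hAB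
    have e1 := h a ha
    have e2 := h b hb
    have : ∑ j, α j * A j + ∑ j, β j * B j
        = (∑ j, α j * a j + ∑ j, β j * tDeriv S (dualCoord S j) p a)
          + Complex.I * (∑ j, α j * b j + ∑ j, β j * tDeriv S (dualCoord S j) p b) := by
      simp only [Finset.mul_sum, mul_add, ← Finset.sum_add_distrib]
      exact Finset.sum_congr rfl fun i _ => by rw [← h1 i, ← h2 i]; ring
    rw [this, e1, e2]; ring
  constructor
  · ext i
    have := key (Pi.single i 1) (Pi.single p₀ (-(dualCoord S i p / p p₀))) (by
      simp [Finset.sum_add_distrib, Pi.single_apply]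
      field_simp
      ring)
    simpa [Pi.single_apply, hβ] using this
  · ext i
    by_cases hi : i = p₀
    · rw [hi, hβ]; rfl
    have := key 0 (Pi.single i 1 + Pi.single p₀ (-(p i / p p₀))) (by
      simp [Finset.sum_add_distrib, Pi.single_apply, mul_add]
      field_simp
      ring)
    simpa [Pi.single_apply, hβ, mul_add, Finset.sum_add_distrib] using this

end

/-! ### The partial derivatives with respect to the coordinates `z_j`, `w_j` -/

section

variable {n : ℕ} {S : Set (Cn n)} {p : Cn n} {p₀ : Fin n}

/-- The standing hypotheses under which the functions `z_j`, and `w_j` for `j ≠ p₀`, form a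
coordinate system for the complexified tangent spaces of `S`. -/
structure IsAdmissible (S : Set (Cn n)) (p₀ : Fin n) : Prop where
  smooth : IsSmoothHypersurface S
  origin : ComplexTangentsAvoidOrigin S
  hessian : HasPositiveHessian S
  pole : ∀ p ∈ S, p p₀ ≠ 0

/-- The functions `z_j` (left summand) and `w_j` (right summand) on `S`. -/
def coordFun (S : Set (Cn n)) : Fin n ⊕ Fin n → Cn n → ℂ :=
  Sum.elim (fun j z => z j) (dualCoord S)

theorem isSmoothFunOn_coordFun (h : IsAdmissible S p₀) (i : Fin n ⊕ Fin n) :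
    IsSmoothFunOn S (coordFun S i) := by
  rcases i with j | j
  · exact isSmoothFunOn_coord j
  · exact isSmoothFunOn_dualCoord h.smooth h.origin j

theorem coordFun_coeff_eq_zero (h : IsAdmissible S p₀) (hp : p ∈ S) {c : Fin n ⊕ Fin n → ℂ}
    (hc₀ : c (Sum.inr p₀) = 0)
    (hc : ∀ v ∈ tangent S p, ∑ i, c i * tDeriv S (coordFun S i) p v = 0) : c = 0 := by
  have := coeff_eq_zero h.smooth h.origin h.hessian hp (h.pole p hp)
    (α := fun j => c (Sum.inl j)) (β := fun j => c (Sum.inr j)) hc₀ (fun v hv => by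
      have h1 := hc v hv
      rw [Fintype.sum_sum_type] at h1
      rw [← h1]
      congr 1
      exact Finset.sum_congr rfl fun j _ => by
        rw [← tDeriv_coord h.smooth hp j hv]; rfl)
  ext i
  rcases i with j | j
  · exact congrFun this.1 j
  · exact congrFun this.2 j

/-- Functions on `ℂⁿ` that restrict to the `coordFun S i` on `S`, except that the redundant
coordinate `w_{p₀}` is replaced by the defining function `ρ`.  They form a coordinate system for
the complexified tangent spaces of `ℂⁿ`. -/
def ambientCoord (p₀ : Fin n) (ρ : Cn n → ℝ) : Fin n ⊕ Fin n → Cn n → ℂ :=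
  Sum.elim (fun j z => z j) fun j z => if j = p₀ then (ρ z : ℂ) else dualFormula ρ z j

/-- The linear combinations of the differentials of the functions `y i`. -/
def combination {ι : Type*} [Fintype ι] (y : ι → Cn n → ℂ) (z : Cn n) :
    (ι → ℂ) →L[ℝ] (Cn n →L[ℝ] ℂ) :=
  ∑ i, ((ContinuousLinearMap.lsmul ℝ ℂ).flip (fderiv ℝ (y i) z)).comp
    (ContinuousLinearMap.proj (R := ℝ) i)

theorem combination_apply {ι : Type*} [Fintype ι] (y : ι → Cn n → ℂ) (z : Cn n) (c : ι → ℂ)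
    (v : Cn n) : combination y z c v = ∑ i, c i * fderiv ℝ (y i) z v := by
  simp [combination]

theorem contDiffOn_combination {ι : Type*} [Fintype ι] {y : ι → Cn n → ℂ} {U : Set (Cn n)}
    (hU : IsOpen U) (hy : ∀ i, ContDiffOn ℝ ∞ (y i) U) : ContDiffOn ℝ ∞ (combination y) U := by
  unfold combination
  refine ContDiffOn.sum fun i _ => ContDiffOn.clm_comp ?_ contDiffOn_const
  exact (ContinuousLinearMap.contDiff _).comp_contDiffOn ((hy i).fderiv_of_isOpen hU (by simp))

theorem finrank_coeff_eq :
    Module.finrank ℝ (Fin n ⊕ Fin n → ℂ) = Module.finrank ℝ (Cn n →L[ℝ] ℂ) := by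
  rw [← (LinearMap.toContinuousLinearMap (𝕜 := ℝ) (E := Cn n) (F' := ℂ)).finrank_eq,
    Module.finrank_linearMap, Module.finrank_pi_fintype, Module.finrank_pi_fintype]
  simp [Complex.finrank_real_complex]
  ring

/-- Near each point of `S`, the `ambientCoord p₀ ρ` are coordinates: every smooth function has
smooth partial derivatives with respect to them. -/
theorem exists_ambientCoord (h : IsAdmissible S p₀) (hp : p ∈ S) :
    ∃ (ρ : Cn n → ℝ) (V : Set (Cn n)), IsOpen V ∧ p ∈ V ∧
      (∀ i, ContDiffOn ℝ ∞ (ambientCoord p₀ ρ i) V) ∧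
      (∀ z ∈ S ∩ V, ∀ v ∈ tangent S z, fderiv ℝ (ambientCoord p₀ ρ (Sum.inr p₀)) z v = 0 ∧
        ∀ i, i ≠ Sum.inr p₀ → fderiv ℝ (ambientCoord p₀ ρ i) z v
          = tDeriv S (coordFun S i) z v) ∧
      ∀ (f : Cn n → ℂ) (V' : Set (Cn n)), IsOpen V' → V' ⊆ V → ContDiffOn ℝ ∞ f V' →
        ∃ c : Cn n → (Fin n ⊕ Fin n → ℂ), ContDiffOn ℝ ∞ c V' ∧
          ∀ z ∈ V', ∀ v, fderiv ℝ f z v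
            = ∑ i, c z i * fderiv ℝ (ambientCoord p₀ ρ i) z v := by
  obtain ⟨ρ, hρ⟩ := h.smooth p hp
  obtain ⟨U, hU, hpU, hs, hN, hw, hUS⟩ := exists_dualFormula_contDiffOn h.origin hp hρ
  set y := ambientCoord p₀ ρ with hydef
  have hy : ∀ i, ContDiffOn ℝ ∞ (y i) U := by
    rintro (j | j)
    · exact (contDiff_apply ℝ ℂ j).contDiffOn
    · by_cases hj : j = p₀
      · simp only [hydef, ambientCoord, Sum.elim_inr, if_pos hj]
        exact Complex.ofRealCLM.contDiff.comp_contDiffOn hs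
      · simp only [hydef, ambientCoord, Sum.elim_inr, if_neg hj]
        exact hw j
  have hy₀ : ∀ z ∈ U, ∀ v, fderiv ℝ (y (Sum.inr p₀)) z v = (fderiv ℝ ρ z v : ℂ) := by
    intro z hz v
    have h1 : y (Sum.inr p₀) = Complex.ofRealCLM ∘ ρ := by
      funext z; simp [hydef, ambientCoord]
    have h2 : HasFDerivAt ρ (fderiv ℝ ρ z) z :=
      ((hs.contDiffAt (hU.mem_nhds hz)).differentiableAt (by simp)).hasFDerivAt
    rw [h1, (Complex.ofRealCLM.hasFDerivAt.comp z h2).fderiv]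
    rfl
  have htan : ∀ z ∈ S ∩ U, ∀ v ∈ tangent S z, fderiv ℝ (y (Sum.inr p₀)) z v = 0 ∧
      ∀ i, i ≠ Sum.inr p₀ → fderiv ℝ (y i) z v = tDeriv S (coordFun S i) z v := by
    intro z hz v hv
    refine ⟨?_, fun i hi => ?_⟩
    · rw [hy₀ z hz.2, (mem_tangent_iff hz.1 (hUS z hz).1 v).1 hv, Complex.ofReal_zero]
    · refine (tDeriv_eq_fderiv h.smooth hz.1
        (((hy i).contDiffAt (hU.mem_nhds hz.2)).differentiableAt (by simp)) ?_ hv).symm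
      filter_upwards [self_mem_nhdsWithin, mem_nhdsWithin_of_mem_nhds (hU.mem_nhds hz.2)]
        with x hx hx'
      rcases i with j | j
      · rfl
      · have hj : j ≠ p₀ := fun e => hi (by rw [e])
        simp only [coordFun, hydef, ambientCoord, Sum.elim_inr, if_neg hj]
        exact (hUS x ⟨hx, hx'⟩).2 j
  have hinj : Function.Injective (combination y p) := by
    rw [injective_iff_map_eq_zero]
    intro c hc
    have hc' : ∀ v, ∑ i, c i * fderiv ℝ (y i) p v = 0 := fun v => by
      rw [← combination_apply, hc]; rfl
    have h1 : Function.update c (Sum.inr p₀) 0 = 0 := by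
      refine coordFun_coeff_eq_zero h hp (by simp) fun v hv => ?_
      refine Eq.trans ?_ (hc' v)
      refine Finset.sum_congr rfl fun i _ => ?_
      by_cases hi : i = Sum.inr p₀
      · rw [hi, (htan p ⟨hp, hpU⟩ v hv).1]; simp
      · rw [Function.update_of_ne hi, (htan p ⟨hp, hpU⟩ v hv).2 i hi]
    have h2 : ∀ i, i ≠ Sum.inr p₀ → c i = 0 := fun i hi => by
      rw [← Function.update_of_ne hi (0 : ℂ) c, h1]; rfl
    ext i
    by_cases hi : i = Sum.inr p₀
    · obtain ⟨v, hv⟩ : ∃ v, fderiv ℝ ρ p v ≠ 0 := by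
        by_contra! hall
        exact hρ.fderiv_ne_zero hp (by ext v; exact hall v)
      have h3 := hc' v
      rw [Finset.sum_eq_single (Sum.inr p₀) (fun i _ hi => by rw [h2 i hi, zero_mul]) (by simp),
        hy₀ p hpU] at h3
      rw [hi]
      exact (mul_eq_zero.1 h3).resolve_right (by exact_mod_cast hv)
    · exact h2 i hi
  let e : (Fin n ⊕ Fin n → ℂ) ≃L[ℝ] (Cn n →L[ℝ] ℂ) :=
    (LinearMap.linearEquivOfInjective (combination y p).toLinearMap hinj
      finrank_coeff_eq).toContinuousLinearEquiv
  have he : (e : (Fin n ⊕ Fin n → ℂ) →L[ℝ] (Cn n →L[ℝ] ℂ)) = combination y p := by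
    ext; rfl
  have hcomb := contDiffOn_combination hU hy
  refine ⟨ρ, U ∩ combination y ⁻¹' Set.range ((↑) : ((Fin n ⊕ Fin n → ℂ) ≃L[ℝ]
    (Cn n →L[ℝ] ℂ)) → ((Fin n ⊕ Fin n → ℂ) →L[ℝ] (Cn n →L[ℝ] ℂ))),
    hcomb.continuousOn.isOpen_inter_preimage hU ContinuousLinearEquiv.isOpen,
    ⟨hpU, e, he⟩, fun i => (hy i).mono Set.inter_subset_left,
    fun z hz => htan z ⟨hz.1, hz.2.1⟩, ?_⟩
  intro f V' hV' hVV hf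
  refine ⟨fun z => ContinuousLinearMap.inverse (combination y z) (fderiv ℝ f z), ?_, ?_⟩
  · refine ContDiffOn.clm_apply ?_ (hf.fderiv_of_isOpen hV' (by simp))
    intro z hz
    obtain ⟨e', he'⟩ := (hVV hz).2
    have h1 : ContDiffAt ℝ ∞ (ContinuousLinearMap.inverse : ((Fin n ⊕ Fin n → ℂ) →L[ℝ]
        (Cn n →L[ℝ] ℂ)) → _) (combination y z) := by
      rw [← he']; exact contDiffAt_map_inverse e'
    have h2 : ContDiffAt ℝ ∞ (combination y) z :=
      hcomb.contDiffAt (hU.mem_nhds (hVV hz).1)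
    exact (h1.comp z h2).contDiffWithinAt
  · intro z hz v
    obtain ⟨e', he'⟩ := (hVV hz).2
    rw [← combination_apply]
    simp only
    rw [← he', ContinuousLinearMap.inverse_equiv]
    simp

/-- `c` is the family of partial derivatives of `u` at `p` with respect to the functions
`coordFun S i`, the derivative with respect to the redundant `w_{p₀}` being `0` by convention. -/
def IsPartial (S : Set (Cn n)) (p₀ : Fin n) (u : Cn n → ℂ) (p : Cn n)
    (c : Fin n ⊕ Fin n → ℂ) : Prop :=
  c (Sum.inr p₀) = 0 ∧ ∀ v ∈ tangent S p, tDeriv S u p v = ∑ i, c i * tDeriv S (coordFun S i) p v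

/-- The partial derivatives of a function on `S` with respect to the functions `coordFun S i`. -/
def partialDeriv (S : Set (Cn n)) (p₀ : Fin n) (i : Fin n ⊕ Fin n) (u : Cn n → ℂ) (p : Cn n) : ℂ :=
  Classical.epsilon (IsPartial S p₀ u p) i

theorem IsPartial.unique (h : IsAdmissible S p₀) (hp : p ∈ S) {u : Cn n → ℂ}
    {c c' : Fin n ⊕ Fin n → ℂ} (hc : IsPartial S p₀ u p c) (hc' : IsPartial S p₀ u p c') :
    c = c' := by
  refine sub_eq_zero.1 (coordFun_coeff_eq_zero h hp (by simp [hc.1, hc'.1]) fun v hv => ?_)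
  simp only [Pi.sub_apply, sub_mul, Finset.sum_sub_distrib]
  rw [← hc.2 v hv, ← hc'.2 v hv, sub_self]

/-- Local form of the partial derivatives of a smooth function on `S`. -/
theorem exists_local_partial (h : IsAdmissible S p₀) (hp : p ∈ S) {u : Cn n → ℂ}
    (hu : IsSmoothFunOn S u) :
    ∃ (ρ : Cn n → ℝ) (V : Set (Cn n)) (f : Cn n → ℂ) (c : Cn n → (Fin n ⊕ Fin n → ℂ)),
      IsOpen V ∧ p ∈ V ∧ (∀ i, ContDiffOn ℝ ∞ (ambientCoord p₀ ρ i) V) ∧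
      (∀ z ∈ S ∩ V, ∀ v ∈ tangent S z, fderiv ℝ (ambientCoord p₀ ρ (Sum.inr p₀)) z v = 0 ∧
        ∀ i, i ≠ Sum.inr p₀ → fderiv ℝ (ambientCoord p₀ ρ i) z v
          = tDeriv S (coordFun S i) z v) ∧
      ContDiffOn ℝ ∞ f V ∧ ContDiffOn ℝ ∞ c V ∧
      (∀ z ∈ V, ∀ v, fderiv ℝ f z v = ∑ i, c z i * fderiv ℝ (ambientCoord p₀ ρ i) z v) ∧
      ∀ z ∈ S ∩ V, IsPartial S p₀ u z (Function.update (c z) (Sum.inr p₀) 0) := by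
  obtain ⟨ρ, V, hV, hpV, hy, htan, hexp⟩ := exists_ambientCoord h hp
  obtain ⟨V', hV', hpV', f, hf, huf⟩ := hu p hp
  have hsub : V ∩ V' ⊆ V := Set.inter_subset_left
  have hf' : ContDiffOn ℝ ∞ f (V ∩ V') := hf.mono Set.inter_subset_right
  obtain ⟨c, hc, hfc⟩ := hexp f (V ∩ V') (hV.inter hV') hsub hf'
  refine ⟨ρ, V ∩ V', f, c, hV.inter hV', ⟨hpV, hpV'⟩, fun i => (hy i).mono hsub,
    fun z hz => htan z ⟨hz.1, hz.2.1⟩, hf', hc, hfc, fun z hz => ⟨by simp, fun v hv => ?_⟩⟩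
  have hn := (hV.inter hV').mem_nhds hz.2
  rw [tDeriv_eq_fderiv h.smooth hz.1 ((hf'.contDiffAt hn).differentiableAt (by simp)) ?_ hv,
    hfc z hz.2]
  · refine Finset.sum_congr rfl fun i _ => ?_
    by_cases hi : i = Sum.inr p₀
    · rw [hi, (htan z ⟨hz.1, hz.2.1⟩ v hv).1]; simp
    · rw [Function.update_of_ne hi, (htan z ⟨hz.1, hz.2.1⟩ v hv).2 i hi]
  · filter_upwards [self_mem_nhdsWithin, mem_nhdsWithin_of_mem_nhds hn] with x hx hx'
    exact huf x ⟨hx, hx'.2⟩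

theorem isPartial_partialDeriv (h : IsAdmissible S p₀) (hp : p ∈ S) {u : Cn n → ℂ}
    (hu : IsSmoothFunOn S u) : IsPartial S p₀ u p (fun i => partialDeriv S p₀ i u p) := by
  obtain ⟨ρ, V, f, c, -, hpV, -, -, -, -, -, hc⟩ := exists_local_partial h hp hu
  exact Classical.epsilon_spec (p := IsPartial S p₀ u p) ⟨_, hc p ⟨hp, hpV⟩⟩

theorem partialDeriv_eq (h : IsAdmissible S p₀) (hp : p ∈ S) {u : Cn n → ℂ}
    (hu : IsSmoothFunOn S u) {c : Fin n ⊕ Fin n → ℂ} (hc : IsPartial S p₀ u p c)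
    (i : Fin n ⊕ Fin n) : partialDeriv S p₀ i u p = c i :=
  congrFun ((isPartial_partialDeriv h hp hu).unique h hp hc) i

theorem tDeriv_eq_sum_partialDeriv (h : IsAdmissible S p₀) (hp : p ∈ S) {u : Cn n → ℂ}
    (hu : IsSmoothFunOn S u) {v : Cn n} (hv : v ∈ tangent S p) :
    tDeriv S u p v = ∑ i, partialDeriv S p₀ i u p * tDeriv S (coordFun S i) p v :=
  (isPartial_partialDeriv h hp hu).2 v hv

theorem partialDeriv_pole (h : IsAdmissible S p₀) (hp : p ∈ S) {u : Cn n → ℂ}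
    (hu : IsSmoothFunOn S u) : partialDeriv S p₀ (Sum.inr p₀) u p = 0 :=
  (isPartial_partialDeriv h hp hu).1

theorem IsSmoothFunOn.partialDeriv (h : IsAdmissible S p₀) {u : Cn n → ℂ}
    (hu : IsSmoothFunOn S u) (i : Fin n ⊕ Fin n) : IsSmoothFunOn S (partialDeriv S p₀ i u) := by
  intro p hp
  obtain ⟨ρ, V, f, c, hV, hpV, -, -, -, hc, -, hcp⟩ := exists_local_partial h hp hu
  refine ⟨V, hV, hpV, fun z => Function.update (c z) (Sum.inr p₀) 0 i, ?_, fun z hz =>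
    partialDeriv_eq h hz.1 hu (hcp z hz) i⟩
  by_cases hi : i = Sum.inr p₀
  · simp only [hi, Function.update_self]; exact contDiffOn_const
  · simp only [Function.update_of_ne hi]; exact contDiffOn_pi.1 hc i

theorem partialDeriv_congr (h : IsAdmissible S p₀) (hp : p ∈ S) {u u' : Cn n → ℂ}
    (hu : IsSmoothFunOn S u) (huu : ∀ z ∈ S, u' z = u z) (i : Fin n ⊕ Fin n) :
    partialDeriv S p₀ i u' p = partialDeriv S p₀ i u p := by
  refine partialDeriv_eq h hp (hu.congr huu) (c := fun i => partialDeriv S p₀ i u p)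
    ⟨partialDeriv_pole h hp hu, fun v hv => ?_⟩ i
  rw [tDeriv_congr_of_eqOn hp huu, tDeriv_eq_sum_partialDeriv h hp hu hv]

theorem partialDeriv_add (h : IsAdmissible S p₀) (hp : p ∈ S) {u u' : Cn n → ℂ}
    (hu : IsSmoothFunOn S u) (hu' : IsSmoothFunOn S u') (i : Fin n ⊕ Fin n) :
    partialDeriv S p₀ i (fun z => u z + u' z) p
      = partialDeriv S p₀ i u p + partialDeriv S p₀ i u' p := by
  refine partialDeriv_eq h hp (hu.add hu')
    (c := fun i => partialDeriv S p₀ i u p + partialDeriv S p₀ i u' p) ⟨?_, fun v hv => ?_⟩ i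
  · simp only [partialDeriv_pole h hp hu, partialDeriv_pole h hp hu', add_zero]
  · rw [tDeriv_add h.smooth hp hu hu' hv, tDeriv_eq_sum_partialDeriv h hp hu hv,
      tDeriv_eq_sum_partialDeriv h hp hu' hv, ← Finset.sum_add_distrib]
    exact Finset.sum_congr rfl fun j _ => by ring

theorem partialDeriv_mul (h : IsAdmissible S p₀) (hp : p ∈ S) {u u' : Cn n → ℂ}
    (hu : IsSmoothFunOn S u) (hu' : IsSmoothFunOn S u') (i : Fin n ⊕ Fin n) :
    partialDeriv S p₀ i (fun z => u z * u' z) p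
      = u p * partialDeriv S p₀ i u' p + u' p * partialDeriv S p₀ i u p := by
  refine partialDeriv_eq h hp (hu.mul hu')
    (c := fun i => u p * partialDeriv S p₀ i u' p + u' p * partialDeriv S p₀ i u p)
    ⟨?_, fun v hv => ?_⟩ i
  · simp only [partialDeriv_pole h hp hu, partialDeriv_pole h hp hu', mul_zero, add_zero]
  · rw [tDeriv_mul h.smooth hp hu hu' hv, tDeriv_eq_sum_partialDeriv h hp hu hv,
      tDeriv_eq_sum_partialDeriv h hp hu' hv, Finset.mul_sum, Finset.mul_sum,
      ← Finset.sum_add_distrib]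
    exact Finset.sum_congr rfl fun j _ => by ring

theorem partialDeriv_const (h : IsAdmissible S p₀) (hp : p ∈ S) (c : ℂ) (i : Fin n ⊕ Fin n) :
    partialDeriv S p₀ i (fun _ => c) p = 0 := by
  refine partialDeriv_eq h hp (isSmoothFunOn_const c) (c := 0) ⟨rfl, fun v hv => ?_⟩ i
  rw [tDeriv_const h.smooth hp c hv]; simp

theorem partialDeriv_coordFun (h : IsAdmissible S p₀) (hp : p ∈ S) (i : Fin n ⊕ Fin n)
    {k : Fin n ⊕ Fin n} (hk : k ≠ Sum.inr p₀) :
    partialDeriv S p₀ i (coordFun S k) p = if i = k then 1 else 0 := by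
  refine partialDeriv_eq h hp (isSmoothFunOn_coordFun h k) (c := fun i => if i = k then 1 else 0)
    ⟨by simp [Ne.symm hk], fun v hv => ?_⟩ i
  simp

/-- The partial derivatives commute: this is the symmetry of the second derivatives of a local
extension, expressed in the coordinates `ambientCoord p₀ ρ`. -/
theorem partialDeriv_comm (h : IsAdmissible S p₀) (hp : p ∈ S) {u : Cn n → ℂ}
    (hu : IsSmoothFunOn S u) (i k : Fin n ⊕ Fin n) :
    partialDeriv S p₀ i (partialDeriv S p₀ k u) p
      = partialDeriv S p₀ k (partialDeriv S p₀ i u) p := by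
  obtain ⟨ρ, V, f, c, hV, hpV, hy, htan, hf, hc, hfc, hcp⟩ := exists_local_partial h hp hu
  set y := ambientCoord p₀ ρ
  have hn := hV.mem_nhds hpV
  have hcd : DifferentiableAt ℝ c p := (hc.contDiffAt hn).differentiableAt (by simp)
  have hyd : ∀ i, DifferentiableAt ℝ (fderiv ℝ (y i)) p := fun i =>
    (((hy i).fderiv_of_isOpen hV (m := ∞) (by simp)).contDiffAt hn).differentiableAt (by simp)
  have hfd : DifferentiableAt ℝ (fderiv ℝ f) p :=
    ((hf.fderiv_of_isOpen hV (m := ∞) (by simp)).contDiffAt hn).differentiableAt (by simp)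
  have hsecond : ∀ a b : Cn n, fderiv ℝ (fderiv ℝ f) p a b
      = ∑ i, (fderiv ℝ c p a i * fderiv ℝ (y i) p b + c p i * fderiv ℝ (fderiv ℝ (y i)) p a b) := by
    intro a b
    have h1 : HasFDerivAt (fun z => fderiv ℝ f z b) _ p :=
      hfd.hasFDerivAt.clm_apply (hasFDerivAt_const b p)
    have h2 : HasFDerivAt (fun z => fderiv ℝ f z b) _ p :=
      (HasFDerivAt.fun_sum (u := Finset.univ) fun i _ =>
        (hasFDerivAt_pi'.1 hcd.hasFDerivAt i).mul
          ((hyd i).hasFDerivAt.clm_apply (hasFDerivAt_const b p))).congr_of_eventuallyEq (by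
        filter_upwards [hn] with z hz using hfc z hz b)
    have h3 := DFunLike.congr_fun (h1.unique h2) a
    simp [sum_apply, -Fintype.sum_sum_type] at h3
    rw [h3]
    exact Finset.sum_congr rfl fun i _ => by ring
  have hsym : ∀ a b : Cn n, ∑ i, fderiv ℝ c p a i * fderiv ℝ (y i) p b
      = ∑ i, fderiv ℝ c p b i * fderiv ℝ (y i) p a := by
    intro a b
    have h1 : fderiv ℝ (fderiv ℝ f) p a b = fderiv ℝ (fderiv ℝ f) p b a :=
      ((hf.contDiffAt hn).isSymmSndFDerivAt minSmoothness_two_le_infty) a b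
    have h2 : ∀ i, fderiv ℝ (fderiv ℝ (y i)) p a b = fderiv ℝ (fderiv ℝ (y i)) p b a := fun i =>
      (((hy i).contDiffAt hn).isSymmSndFDerivAt minSmoothness_two_le_infty) a b
    rw [hsecond, hsecond, Finset.sum_add_distrib, Finset.sum_add_distrib] at h1
    simp only [h2] at h1
    exact add_right_cancel h1
  have hD : ∀ i, i ≠ Sum.inr p₀ → ∀ v ∈ tangent S p,
      fderiv ℝ c p v i = tDeriv S (partialDeriv S p₀ i u) p v := by
    intro i hi v hv
    have h1 := hasFDerivAt_pi'.1 hcd.hasFDerivAt i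
    rw [tDeriv_eq_fderiv h.smooth hp h1.differentiableAt ?_ hv, h1.fderiv]
    · rfl
    · filter_upwards [self_mem_nhdsWithin, mem_nhdsWithin_of_mem_nhds hn] with z hz hz'
      rw [partialDeriv_eq h hz hu (hcp z ⟨hz, hz'⟩) i, Function.update_of_ne hi]
  have hpole : ∀ v ∈ tangent S p, tDeriv S (partialDeriv S p₀ (Sum.inr p₀) u) p v = 0 := by
    intro v hv
    rw [tDeriv_congr_of_eqOn hp (u' := fun _ => 0) (fun z hz => partialDeriv_pole h hz hu),
      tDeriv_const h.smooth hp 0 hv]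
  have hDsum : ∀ a ∈ tangent S p, ∀ b ∈ tangent S p, ∑ i, fderiv ℝ c p a i * fderiv ℝ (y i) p b
      = ∑ i, tDeriv S (partialDeriv S p₀ i u) p a * tDeriv S (coordFun S i) p b := by
    intro a ha b hb
    refine Finset.sum_congr rfl fun i _ => ?_
    by_cases hi : i = Sum.inr p₀
    · rw [hi, hpole a ha, (htan p ⟨hp, hpV⟩ b hb).1]; simp
    · rw [hD i hi a ha, (htan p ⟨hp, hpV⟩ b hb).2 i hi]
  set m : Fin n ⊕ Fin n → Fin n ⊕ Fin n → ℂ := fun k i =>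
    partialDeriv S p₀ k (partialDeriv S p₀ i u) p with hm
  have hexp : ∀ i, ∀ a ∈ tangent S p, tDeriv S (partialDeriv S p₀ i u) p a
      = ∑ k, m k i * tDeriv S (coordFun S k) p a := fun i a ha =>
    tDeriv_eq_sum_partialDeriv h hp (hu.partialDeriv h i) ha
  have hm₁ : ∀ i, m (Sum.inr p₀) i = 0 := fun i => partialDeriv_pole h hp (hu.partialDeriv h i)
  have hm₂ : ∀ k, m k (Sum.inr p₀) = 0 := fun k => by
    rw [hm]; simp only
    rw [partialDeriv_congr h hp (isSmoothFunOn_const 0) (fun z hz => partialDeriv_pole h hz hu),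
      partialDeriv_const h hp]
  have h1 : ∀ a ∈ tangent S p,
      (fun i => ∑ k, (m k i - m i k) * tDeriv S (coordFun S k) p a) = 0 := by
    intro a ha
    refine coordFun_coeff_eq_zero h hp (by simp [hm₁, hm₂]) fun b hb => ?_
    have h2 := hsym a b
    rw [hDsum a ha b hb, hDsum b hb a ha] at h2
    simp only [hexp _ a ha, hexp _ b hb, Finset.sum_mul] at h2
    rw [Finset.sum_comm (f := fun i k => m k i * tDeriv S (coordFun S k) p b
      * tDeriv S (coordFun S i) p a), ← sub_eq_zero, ← Finset.sum_sub_distrib] at h2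
    rw [← h2]
    refine Finset.sum_congr rfl fun i _ => ?_
    rw [Finset.sum_mul, ← Finset.sum_sub_distrib]
    exact Finset.sum_congr rfl fun k _ => by ring
  have h2 : (fun i' => m i' k - m k i') = 0 :=
    coordFun_coeff_eq_zero h hp (by simp [hm₁, hm₂]) fun a ha => congrFun (h1 a ha) k
  exact sub_eq_zero.1 (congrFun h2 i)

end

/-! ### Closed one-forms on a simply connected hypersurface -/

section

variable {n : ℕ} {S : Set (Cn n)} {p : Cn n}

/-- Local parametrization: near `p` the hypersurface is the image of a convex open set `N` under a
smooth map `φ`, and `φ` has a smooth right inverse `Ψ` on `S`.  The map `Ψ` straightens `S` to a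
real hyperplane, and `φ` is its inverse composed with a projection to that hyperplane; hence the
domain of `φ` can be taken in the ambient space. -/
theorem exists_parametrization (hS : IsSmoothHypersurface S) (hp : p ∈ S) {W : Set (Cn n)}
    (hW : W ∈ 𝓝 p) :
    ∃ (U N : Set (Cn n)) (Ψ φ : Cn n → Cn n), IsOpen U ∧ p ∈ U ∧ U ⊆ W ∧ IsOpen N ∧ Convex ℝ N ∧
      ContDiffOn ℝ ∞ Ψ U ∧ ContDiffOn ℝ ∞ φ N ∧ Set.MapsTo Ψ U N ∧ Set.MapsTo φ N (S ∩ U) ∧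
      ∀ z ∈ S ∩ U, φ (Ψ z) = z := by
  obtain ⟨ρ, U₀, hU₀, hpU₀, hρs, hρ0, hρd⟩ := hS p hp
  set ℓ := fderiv ℝ ρ p with hℓ
  obtain ⟨e, he⟩ : ∃ e, ℓ e = 1 := by
    obtain ⟨v, hv⟩ : ∃ v, ℓ v ≠ 0 := by
      by_contra! hall
      exact hρd p ⟨hpU₀, hp⟩ (by ext v; exact hall v)
    exact ⟨(ℓ v)⁻¹ • v, by rw [map_smul, smul_eq_mul, inv_mul_cancel₀ hv]⟩
  set Ψ : Cn n → Cn n := fun z => (z - p) + (ρ z - ℓ (z - p)) • e with hΨ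
  have hℓΨ : ∀ z, ℓ (Ψ z) = ρ z := by
    intro z
    simp only [hΨ, map_add, map_smul, he, smul_eq_mul]; ring
  have hΨs : ContDiffOn ℝ ∞ Ψ U₀ := by
    have h1 : ContDiff ℝ ∞ (fun z : Cn n => z - p) := contDiff_id.sub contDiff_const
    exact h1.contDiffOn.add
      ((hρs.sub (ℓ.contDiff.comp h1).contDiffOn).smul contDiffOn_const)
  have hΨp : Ψ p = 0 := by simp [hΨ, (hρ0 p hpU₀).1 hp]
  have hΨd : HasFDerivAt Ψ ((ContinuousLinearEquiv.refl ℝ (Cn n) : Cn n ≃L[ℝ] Cn n) :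
      Cn n →L[ℝ] Cn n) p := by
    have h1 : HasFDerivAt (fun z : Cn n => z - p) (ContinuousLinearMap.id ℝ (Cn n)) p :=
      (hasFDerivAt_id p).sub_const p
    have h2 : HasFDerivAt ρ ℓ p :=
      ((hρs.contDiffAt (hU₀.mem_nhds hpU₀)).differentiableAt (by simp)).hasFDerivAt
    have h3 : HasFDerivAt (fun z : Cn n => ρ z - ℓ (z - p)) (ℓ - ℓ) p :=
      h2.sub (ℓ.hasFDerivAt.comp p h1)
    have h4 := h1.add (h3.smul_const e)
    convert! h4 using 1
    ext v
    simp
  set h := (hΨs.contDiffAt (hU₀.mem_nhds hpU₀)).toOpenPartialHomeomorph Ψ hΨd (by simp) with hh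
  have hcoe : ∀ z, h z = Ψ z := fun z => rfl
  set O : Set (Cn n) := h.source ∩ ((U₀ ∩ fderiv ℝ Ψ ⁻¹' Set.range
    ((↑) : (Cn n ≃L[ℝ] Cn n) → (Cn n →L[ℝ] Cn n))) ∩ interior W) with hO
  have hOo : IsOpen O := h.open_source.inter
    (((hΨs.fderiv_of_isOpen (m := ∞) hU₀ (by simp)).continuousOn.isOpen_inter_preimage hU₀
      ContinuousLinearEquiv.isOpen).inter isOpen_interior)
  have hpO : p ∈ O := ⟨(hΨs.contDiffAt (hU₀.mem_nhds hpU₀)).mem_toOpenPartialHomeomorph_source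
    hΨd (by simp), ⟨hpU₀, _, hΨd.fderiv.symm⟩, mem_interior_iff_mem_nhds.2 hW⟩
  have hOU₀ : O ⊆ U₀ := fun z hz => hz.2.1.1
  set T : Set (Cn n) := h.target ∩ h.symm ⁻¹' O with hT
  have hTo : IsOpen T := h.isOpen_inter_preimage_symm hOo
  have h0T : (0 : Cn n) ∈ T := by
    rw [← hΨp, ← hcoe]
    exact ⟨h.map_source hpO.1, by rw [Set.mem_preimage, h.left_inv hpO.1]; exact hpO⟩
  have hsymm : ContDiffOn ℝ ∞ h.symm T := by
    intro y hy
    obtain ⟨e', he'⟩ := hy.2.2.1.2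
    have h1 : ContDiffAt ℝ ∞ Ψ (h.symm y) :=
      hΨs.contDiffAt (hU₀.mem_nhds hy.2.2.1.1)
    refine (h.contDiffAt_symm hy.1 (f₀' := e') ?_ h1).contDiffWithinAt
    rw [he']
    exact (h1.differentiableAt (by simp)).hasFDerivAt
  obtain ⟨ε, hε, hball⟩ := Metric.isOpen_iff.1 hTo 0 h0T
  set Q : Cn n →L[ℝ] Cn n := ContinuousLinearMap.id ℝ (Cn n) - ℓ.smulRight e with hQ
  have hQa : ∀ y, Q y = y - ℓ y • e := fun y => by simp [hQ]
  have hℓQ : ∀ y, ℓ (Q y) = 0 := fun y => by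
    rw [hQa, map_sub, map_smul, he, smul_eq_mul, mul_one, sub_self]
  have hQfix : ∀ y, ℓ y = 0 → Q y = y := fun y hy => by rw [hQa, hy, zero_smul, sub_zero]
  set N : Set (Cn n) := Q ⁻¹' Metric.ball 0 ε with hN
  have hNo : IsOpen N := Metric.isOpen_ball.preimage Q.continuous
  have hNc : Convex ℝ N := (convex_ball (0 : Cn n) ε).linear_preimage Q.toLinearMap
  refine ⟨O ∩ Ψ ⁻¹' N, N, Ψ, fun y => h.symm (Q y),
    (hΨs.mono hOU₀).continuousOn.isOpen_inter_preimage hOo hNo, ⟨hpO, ?_⟩,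
    fun z hz => interior_subset hz.1.2.2, hNo, hNc,
    hΨs.mono fun z hz => hOU₀ hz.1, ?_, fun z hz => hz.2, ?_, ?_⟩
  · change Q (Ψ p) ∈ Metric.ball (0 : Cn n) ε
    rw [hΨp, map_zero]; exact Metric.mem_ball_self hε
  · exact hsymm.comp Q.contDiff.contDiffOn fun y hy => hball hy
  · intro y hy
    have hyT := hball hy
    have h1 : Ψ (h.symm (Q y)) = Q y := h.right_inv hyT.1
    refine ⟨(hρ0 _ (hOU₀ hyT.2)).2 ?_, hyT.2, ?_⟩
    · rw [← hℓΨ, h1, hℓQ]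
    · change Q (Ψ (h.symm (Q y))) ∈ Metric.ball (0 : Cn n) ε
      rw [h1, hQfix _ (hℓQ y)]; exact hy
  · intro z hz
    have h1 : ρ z = 0 := (hρ0 z (hOU₀ hz.2.1)).1 hz.1
    simp only
    rw [hQfix _ (by rw [hℓΨ, h1])]
    exact h.left_inv hz.2.1.1

/-- The differential of a map into `S` takes values in the tangent spaces of `S`. -/
theorem fderiv_mem_tangent (hS : IsSmoothHypersurface S) {N : Set (Cn n)} (hN : IsOpen N)
    {φ : Cn n → Cn n} (hφ : DifferentiableOn ℝ φ N) (hφS : Set.MapsTo φ N S) {y : Cn n}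
    (hy : y ∈ N) (a : Cn n) : fderiv ℝ φ y a ∈ tangent S (φ y) := by
  obtain ⟨ρ, hρ⟩ := hS (φ y) (hφS hy)
  rw [mem_tangent_iff (hφS hy) hρ]
  have hρd : DifferentiableAt ℝ ρ (φ y) := hρ.contDiffAt.differentiableAt (by simp)
  obtain ⟨U, hU, hyU, -, hρ0, -⟩ := hρ
  have hφd := (hφ y hy).differentiableAt (hN.mem_nhds hy)
  have h1 : HasFDerivAt (ρ ∘ φ) ((fderiv ℝ ρ (φ y)).comp (fderiv ℝ φ y)) y :=
    hρd.hasFDerivAt.comp y hφd.hasFDerivAt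
  have h2 : HasFDerivAt (ρ ∘ φ) (0 : Cn n →L[ℝ] ℝ) y := by
    refine (hasFDerivAt_const (0 : ℝ) y).congr_of_eventuallyEq ?_
    filter_upwards [hN.mem_nhds hy, hφd.continuousAt.eventually (hU.mem_nhds hyU)] with x hx hx'
    exact (hρ0 _ hx').1 (hφS hx)
  exact DFunLike.congr_fun (h1.unique h2) a

/-- A function whose differential vanishes on the tangent spaces of `S` is locally constant
on `S`. -/
theorem eventually_eq_of_fderiv_tangent_eq_zero (hS : IsSmoothHypersurface S) (hp : p ∈ S)
    {V : Set (Cn n)} (hV : IsOpen V) (hpV : p ∈ V) {g : Cn n → ℂ} (hg : DifferentiableOn ℝ g V)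
    (hg0 : ∀ z ∈ S ∩ V, ∀ v ∈ tangent S z, fderiv ℝ g z v = 0) :
    ∀ᶠ z in 𝓝[S] p, g z = g p := by
  obtain ⟨U, N, Ψ, φ, hU, hpU, hUV, hN, hNc, hΨ, hφ, hΨN, hφS, hφΨ⟩ :=
    exists_parametrization hS hp (hV.mem_nhds hpV)
  have hφd : DifferentiableOn ℝ φ N := hφ.differentiableOn (by simp)
  have hgφ : DifferentiableOn ℝ (g ∘ φ) N := hg.comp hφd fun y hy => hUV (hφS hy).2
  have hconst : ∀ y ∈ N, ∀ y' ∈ N, (g ∘ φ) y = (g ∘ φ) y' := by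
    intro y hy y' hy'
    refine hNc.is_const_of_fderivWithin_eq_zero (𝕜 := ℝ) hgφ (fun x hx => ?_) hy hy'
    rw [fderivWithin_of_isOpen hN hx, fderiv_comp x
      ((hg _ (hUV (hφS hx).2)).differentiableAt (hV.mem_nhds (hUV (hφS hx).2)))
      ((hφd x hx).differentiableAt (hN.mem_nhds hx))]
    ext a
    exact hg0 _ ⟨(hφS hx).1, hUV (hφS hx).2⟩ _
      (fderiv_mem_tangent hS hN hφd (fun y hy => (hφS hy).1) hx a)
  filter_upwards [self_mem_nhdsWithin, mem_nhdsWithin_of_mem_nhds (hU.mem_nhds hpU)] with z hz hz'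
  have := hconst _ (hΨN hz') _ (hΨN hpU)
  simpa only [Function.comp_apply, hφΨ z ⟨hz, hz'⟩, hφΨ p ⟨hp, hpU⟩] using this

theorem locallyPathConnectedSpace (hS : IsSmoothHypersurface S) : LocallyPathConnectedSpace S := by
  refine ⟨fun x => Filter.hasBasis_self.2 fun t ht => ?_⟩
  obtain ⟨W, hW, hWt⟩ := (mem_nhds_subtype S x t).1 ht
  obtain ⟨U, N, Ψ, φ, hU, hpU, hUW, hN, hNc, hΨ, hφ, hΨN, hφS, hφΨ⟩ :=
    exists_parametrization hS x.2 hW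
  refine ⟨Subtype.val ⁻¹' U, (hU.preimage continuous_subtype_val).mem_nhds hpU, ?_,
    fun y hy => hWt (hUW hy)⟩
  rw [Topology.IsInducing.subtypeVal.isPathConnected_iff, Subtype.image_preimage_coe]
  have himg : S ∩ U = φ '' N := by
    ext z
    constructor
    · exact fun hz => ⟨Ψ z, hΨN hz.2, hφΨ z hz⟩
    · rintro ⟨y, hy, rfl⟩; exact hφS hy
  rw [himg]
  exact (hNc.isPathConnected ⟨_, hΨN hpU⟩).image' hφ.continuousOn

/-- Poincaré lemma on `S`: the form `∑ C_j dz_j` has local primitives if it is closed. -/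
theorem exists_local_primitive (hS : IsSmoothHypersurface S) {C : Fin n → Cn n → ℂ}
    (hC : ∀ j, IsSmoothFunOn S (C j))
    (hclosed : ∀ z ∈ S, ∀ a ∈ tangent S z, ∀ b ∈ tangent S z,
      ∑ j, tDeriv S (C j) z a * b j = ∑ j, tDeriv S (C j) z b * a j) (hp : p ∈ S) :
    ∃ (U : Set (Cn n)) (F : Cn n → ℂ), IsOpen U ∧ p ∈ U ∧ ContDiffOn ℝ ∞ F U ∧
      ∀ z ∈ S ∩ U, ∀ v ∈ tangent S z, fderiv ℝ F z v = ∑ j, C j z * v j := by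
  choose V hV hpV c hc hCc using fun j => hC j p hp
  obtain ⟨U, N, Ψ, φ, hU, hpU, hUW, hN, hNc, hΨ, hφ, hΨN, hφS, hφΨ⟩ :=
    exists_parametrization hS hp ((Filter.iInter_mem (f := 𝓝 p)).2 fun j =>
      (hV j).mem_nhds (hpV j))
  have hUV : ∀ j, U ⊆ V j := fun j z hz => Set.mem_iInter.1 (hUW hz) j
  have hφd : DifferentiableOn ℝ φ N := hφ.differentiableOn (by simp)
  have hφ' : ContDiffOn ℝ ∞ (fderiv ℝ φ) N := hφ.fderiv_of_isOpen hN (by simp)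
  have hcφ : ∀ j, ContDiffOn ℝ ∞ (fun y => c j (φ y)) N := fun j =>
    (hc j).comp hφ fun y hy => hUV j (hφS hy).2
  set η : Cn n → Cn n →L[ℝ] ℂ := fun y =>
    ∑ j, c j (φ y) • (ContinuousLinearMap.proj (R := ℝ) j).comp (fderiv ℝ φ y) with hη
  have hηa : ∀ y b, η y b = ∑ j, c j (φ y) * fderiv ℝ φ y b j := fun y b => by simp [hη]
  have hηs : ContDiffOn ℝ ∞ η N := ContDiffOn.sum fun j _ =>
    (hcφ j).smul (contDiffOn_const.clm_comp hφ')
  have hηd : DifferentiableOn ℝ η N := hηs.differentiableOn (by simp)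
  have htan : ∀ y ∈ N, ∀ a, fderiv ℝ φ y a ∈ tangent S (φ y) := fun y hy a =>
    fderiv_mem_tangent hS hN hφd (fun y hy => (hφS hy).1) hy a
  have hcd : ∀ j, ∀ y ∈ N, DifferentiableAt ℝ (c j) (φ y) := fun j y hy =>
    ((hc j).contDiffAt ((hV j).mem_nhds (hUV j (hφS hy).2))).differentiableAt (by simp)
  have hCder : ∀ j, ∀ y ∈ N, ∀ a, fderiv ℝ (c j) (φ y) (fderiv ℝ φ y a)
      = tDeriv S (C j) (φ y) (fderiv ℝ φ y a) := by
    intro j y hy a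
    refine (tDeriv_eq_fderiv hS (hφS hy).1 (hcd j y hy) ?_ (htan y hy a)).symm
    filter_upwards [self_mem_nhdsWithin, mem_nhdsWithin_of_mem_nhds
      ((hV j).mem_nhds (hUV j (hφS hy).2))] with x hx hx' using hCc j x ⟨hx, hx'⟩
  have hηder : ∀ y ∈ N, ∀ a b, fderiv ℝ η y a b
      = ∑ j, tDeriv S (C j) (φ y) (fderiv ℝ φ y a) * fderiv ℝ φ y b j
        + ∑ j, c j (φ y) * fderiv ℝ (fderiv ℝ φ) y a b j := by
    intro y hy a b
    have hny := hN.mem_nhds hy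
    have h1 : HasFDerivAt (fun y => η y b) _ y :=
      ((hηd y hy).differentiableAt hny).hasFDerivAt.clm_apply (hasFDerivAt_const b y)
    have hφ'd : HasFDerivAt (fun y => fderiv ℝ φ y b) _ y :=
      ((hφ'.contDiffAt hny).differentiableAt (by simp)).hasFDerivAt.clm_apply
        (hasFDerivAt_const b y)
    have h2 : HasFDerivAt (fun y => η y b) _ y :=
      (HasFDerivAt.fun_sum (u := Finset.univ) fun j _ =>
        ((hcd j y hy).hasFDerivAt.comp y ((hφd y hy).differentiableAt hny).hasFDerivAt).mul
          (hasFDerivAt_pi'.1 hφ'd j)).congr_of_eventuallyEq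
        (Filter.Eventually.of_forall fun y => hηa y b)
    have h3 := DFunLike.congr_fun (h1.unique h2) a
    simp [sum_apply, hCder _ y hy] at h3
    rw [h3, ← Finset.sum_add_distrib]
    exact Finset.sum_congr rfl fun j _ => by ring
  obtain ⟨G, hG⟩ := hNc.exists_forall_hasFDerivAt_of_fderiv_symmetric hN hηd (by
    intro y hy a b
    have h1 : fderiv ℝ (fderiv ℝ φ) y a b = fderiv ℝ (fderiv ℝ φ) y b a :=
      ((hφ.contDiffAt (hN.mem_nhds hy)).isSymmSndFDerivAt minSmoothness_two_le_infty) a b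
    rw [hηder y hy, hηder y hy, h1,
      hclosed _ (hφS hy).1 _ (htan y hy a) _ (htan y hy b)])
  have hGs : ContDiffOn ℝ ∞ G N := by
    rw [contDiffOn_infty_iff_fderiv_of_isOpen hN]
    refine ⟨fun y hy => (hG y hy).differentiableAt.differentiableWithinAt, ?_⟩
    exact hηs.congr fun y hy => (hG y hy).fderiv
  refine ⟨U, G ∘ Ψ, hU, hpU, hGs.comp hΨ hΨN, fun z hz v hv => ?_⟩
  have hΨd : DifferentiableAt ℝ Ψ z :=
    (hΨ.contDiffAt (hU.mem_nhds hz.2)).differentiableAt (by simp)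
  have hφz := (hφd _ (hΨN hz.2)).differentiableAt (hN.mem_nhds (hΨN hz.2))
  have hcomp : HasFDerivAt (φ ∘ Ψ) ((fderiv ℝ φ (Ψ z)).comp (fderiv ℝ Ψ z)) z :=
    hφz.hasFDerivAt.comp z hΨd.hasFDerivAt
  have hid : ∀ j, fderiv ℝ φ (Ψ z) (fderiv ℝ Ψ z v) j = v j := by
    intro j
    have h1 := hasFDerivAt_pi'.1 hcomp j
    have h2 := tDeriv_eq_fderiv (u := fun z => z j) hS hz.1 h1.differentiableAt (by
      filter_upwards [self_mem_nhdsWithin, mem_nhdsWithin_of_mem_nhds (hU.mem_nhds hz.2)]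
        with x hx hx'
      rw [Function.comp_apply, hφΨ x ⟨hx, hx'⟩]) hv
    rw [tDeriv_coord hS hz.1 j hv, h1.fderiv] at h2
    exact h2.symm
  rw [((hG _ (hΨN hz.2)).comp z hΨd.hasFDerivAt).fderiv]
  rw [ContinuousLinearMap.comp_apply, hηa]
  refine Finset.sum_congr rfl fun j _ => ?_
  rw [hid, hφΨ z hz, hCc j z ⟨hz.1, hUV j hz.2⟩]

/-- On a simply connected hypersurface, a closed form `∑ C_j dz_j` is exact. -/
theorem exists_primitive (hS : IsSmoothHypersurface S) (hsc : SimplyConnectedSpace S)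
    {C : Fin n → Cn n → ℂ} (hC : ∀ j, IsSmoothFunOn S (C j))
    (hclosed : ∀ z ∈ S, ∀ a ∈ tangent S z, ∀ b ∈ tangent S z,
      ∑ j, tDeriv S (C j) z a * b j = ∑ j, tDeriv S (C j) z b * a j) :
    ∃ f : Cn n → ℂ, IsSmoothFunOn S f ∧
      ∀ z ∈ S, ∀ v ∈ tangent S z, tDeriv S f z v = ∑ j, C j z * v j := by
  have := locallyPathConnectedSpace hS
  choose U F hU hxU hF hFd using fun x : S => exists_local_primitive hS hC hclosed x.2
  have hFdiff : ∀ x, DifferentiableOn ℝ (F x) (U x) := fun x =>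
    (hF x).differentiableOn (by simp)
  obtain ⟨f, hf⟩ := exists_glue_of_locally_const (fun x : S => (Subtype.val ⁻¹' U x : Set S))
    (fun x => (hU x).preimage continuous_subtype_val) hxU (fun x q => F x q) (by
      intro x y q hq
      refine (eventually_nhds_subtype_iff S q (fun z => F x z - F y z = F x q - F y q)).2 ?_
      have hd : ∀ x, ∀ z ∈ U x, DifferentiableAt ℝ (F x) z := fun x z hz =>
        (hFdiff x z hz).differentiableAt ((hU x).mem_nhds hz)
      refine eventually_eq_of_fderiv_tangent_eq_zero (g := fun z => F x z - F y z) hS q.2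
        ((hU x).inter (hU y)) hq
        (((hFdiff x).mono Set.inter_subset_left).sub ((hFdiff y).mono Set.inter_subset_right)) ?_
      intro z hz v hv
      rw [fderiv_fun_sub (hd x z hz.2.1) (hd y z hz.2.2), sub_apply,
        hFd x z ⟨hz.1, hz.2.1⟩ v hv, hFd y z ⟨hz.1, hz.2.2⟩ v hv, sub_self])
  classical
  set f' : Cn n → ℂ := fun z => if hz : z ∈ S then f ⟨z, hz⟩ else 0 with hf'
  have hf'S : ∀ q : S, f' q = f q := fun q => by simp [hf']
  have hloc : ∀ q : S, ∀ᶠ z in 𝓝[S] (q : Cn n), f' z = F q z + (f q - F q q) := by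
    intro q
    have h1 := hf q q (hxU q)
    have h2 : ∀ᶠ x : S in 𝓝 q, f' x = F q x + (f q - F q q) := by
      filter_upwards [h1] with x hx
      rw [hf'S, ← hx]; ring
    exact (eventually_nhds_subtype_iff S q (fun z => f' z = F q z + (f q - F q q))).1 h2
  refine ⟨f', fun p hp => ?_, fun p hp v hv => ?_⟩
  · obtain ⟨W, hW, hpW, hWS⟩ := mem_nhdsWithin.1 (hloc ⟨p, hp⟩)
    refine ⟨U ⟨p, hp⟩ ∩ W, (hU _).inter hW, ⟨hxU ⟨p, hp⟩, hpW⟩, _,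
      ((hF ⟨p, hp⟩).mono Set.inter_subset_left).add contDiffOn_const, fun z hz =>
        hWS ⟨hz.2.2, hz.1⟩⟩
  · have hd : DifferentiableAt ℝ (F ⟨p, hp⟩) p :=
      (hFdiff ⟨p, hp⟩ p (hxU ⟨p, hp⟩)).differentiableAt ((hU _).mem_nhds (hxU ⟨p, hp⟩))
    rw [tDeriv_eq_fderiv hS hp (hd.add_const _) (hloc ⟨p, hp⟩) hv, fderiv_add_const]
    exact hFd ⟨p, hp⟩ p ⟨hp, hxU ⟨p, hp⟩⟩ v hv

end

/-! ### The algebra of smooth functions on `S` -/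

section

variable {n : ℕ} {S : Set (Cn n)} {p : Cn n} {p₀ : Fin n}

/-- Extension by zero of a function on the subtype `S`. -/
def extendZero (u : S → ℂ) : Cn n → ℂ := Function.extend Subtype.val u 0

theorem extendZero_apply (u : S → ℂ) (q : S) : extendZero u q = u q :=
  Subtype.val_injective.extend_apply u 0 q

theorem extendZero_of_mem (u : S → ℂ) {z : Cn n} (hz : z ∈ S) : extendZero u z = u ⟨z, hz⟩ :=
  extendZero_apply u ⟨z, hz⟩

/-- The algebra of smooth complex valued functions on `S`. -/
def smoothAlg (S : Set (Cn n)) : Subalgebra ℂ (S → ℂ) where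
  carrier := {u | IsSmoothFunOn S (extendZero u)}
  mul_mem' := fun {u u'} hu hu' => (IsSmoothFunOn.mul hu hu').congr fun z hz => by
    simp [extendZero_of_mem _ hz]
  add_mem' := fun {u u'} hu hu' => (IsSmoothFunOn.add hu hu').congr fun z hz => by
    simp [extendZero_of_mem _ hz]
  algebraMap_mem' := fun c => (isSmoothFunOn_const c).congr fun z hz => by
    simp [extendZero_of_mem _ hz]

theorem isSmoothFunOn_extendZero (a : smoothAlg S) : IsSmoothFunOn S (extendZero a.1) := a.2

/-- A smooth function on `S` as an element of the algebra `smoothAlg S`. -/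
def toSmoothAlg (u : Cn n → ℂ) (hu : IsSmoothFunOn S u) : smoothAlg S :=
  ⟨fun q => u q, hu.congr fun _ hz => extendZero_of_mem _ hz⟩

theorem toSmoothAlg_apply {u : Cn n → ℂ} (hu : IsSmoothFunOn S u) (q : S) :
    (toSmoothAlg u hu).1 q = u q := rfl

theorem extendZero_toSmoothAlg {u : Cn n → ℂ} (hu : IsSmoothFunOn S u) :
    ∀ z ∈ S, extendZero (toSmoothAlg u hu).1 z = u z :=
  fun _ hz => extendZero_of_mem _ hz

theorem isUnit_toSmoothAlg {u : Cn n → ℂ} (hu : IsSmoothFunOn S u) (h0 : ∀ z ∈ S, u z ≠ 0) :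
    IsUnit (toSmoothAlg u hu) :=
  IsUnit.of_mul_eq_one (toSmoothAlg _ (hu.inv h0))
    (Subtype.ext (funext fun q => mul_inv_cancel₀ (h0 q q.2)))

/-- The partial derivatives as derivations of `smoothAlg S`. -/
def smoothDeriv (h : IsAdmissible S p₀) (i : Fin n ⊕ Fin n) :
    Derivation ℂ (smoothAlg S) (smoothAlg S) :=
  Derivation.mk'
    { toFun := fun a => toSmoothAlg (partialDeriv S p₀ i (extendZero a.1))
        ((isSmoothFunOn_extendZero a).partialDeriv h i)
      map_add' := fun a b => Subtype.ext (funext fun q => by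
        change partialDeriv S p₀ i _ q = partialDeriv S p₀ i _ q + partialDeriv S p₀ i _ q
        rw [← partialDeriv_add h q.2 (isSmoothFunOn_extendZero a) (isSmoothFunOn_extendZero b),
          partialDeriv_congr h q.2 ((isSmoothFunOn_extendZero a).add (isSmoothFunOn_extendZero b))]
        intro z hz
        simp [extendZero_of_mem _ hz])
      map_smul' := fun c a => Subtype.ext (funext fun q => by
        change partialDeriv S p₀ i _ q = c * partialDeriv S p₀ i _ q
        rw [partialDeriv_congr h q.2 ((isSmoothFunOn_const c).mul (isSmoothFunOn_extendZero a)),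
          partialDeriv_mul h q.2 (isSmoothFunOn_const c) (isSmoothFunOn_extendZero a),
          partialDeriv_const h q.2]
        · ring
        · intro z hz
          simp [extendZero_of_mem _ hz]) }
    (fun a b => Subtype.ext (funext fun q => by
      change partialDeriv S p₀ i _ q
        = a.1 q * partialDeriv S p₀ i _ q + b.1 q * partialDeriv S p₀ i _ q
      rw [partialDeriv_congr h q.2 ((isSmoothFunOn_extendZero a).mul (isSmoothFunOn_extendZero b)),
        partialDeriv_mul h q.2 (isSmoothFunOn_extendZero a) (isSmoothFunOn_extendZero b),
        extendZero_apply, extendZero_apply]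
      intro z hz
      simp [extendZero_of_mem _ hz]))

theorem smoothDeriv_toSmoothAlg (h : IsAdmissible S p₀) (i : Fin n ⊕ Fin n) {u : Cn n → ℂ}
    (hu : IsSmoothFunOn S u) :
    smoothDeriv h i (toSmoothAlg u hu)
      = toSmoothAlg (partialDeriv S p₀ i u) (hu.partialDeriv h i) :=
  Subtype.ext (funext fun q => partialDeriv_congr h q.2 hu (extendZero_toSmoothAlg hu) i)

theorem smoothDeriv_comm (h : IsAdmissible S p₀) (i k : Fin n ⊕ Fin n) (a : smoothAlg S) :
    smoothDeriv h i (smoothDeriv h k a) = smoothDeriv h k (smoothDeriv h i a) := by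
  have key : ∀ i k : Fin n ⊕ Fin n, ∀ q : S, (smoothDeriv h i (smoothDeriv h k a)).1 q
      = partialDeriv S p₀ i (partialDeriv S p₀ k (extendZero a.1)) q := by
    intro i k q
    have : smoothDeriv h k a = toSmoothAlg _ ((isSmoothFunOn_extendZero a).partialDeriv h k) := rfl
    rw [this, smoothDeriv_toSmoothAlg]; rfl
  refine Subtype.ext (funext fun q => ?_)
  rw [key, key, partialDeriv_comm h q.2 (isSmoothFunOn_extendZero a)]

/-- The coordinates `z_j`, `w_j` as elements of `smoothAlg S`. -/
def coordAlg (h : IsAdmissible S p₀) (i : Fin n ⊕ Fin n) : smoothAlg S :=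
  toSmoothAlg (coordFun S i) (isSmoothFunOn_coordFun h i)

theorem smoothDeriv_coordAlg (h : IsAdmissible S p₀) (i : Fin n ⊕ Fin n) {k : Fin n ⊕ Fin n}
    (hk : k ≠ Sum.inr p₀) : smoothDeriv h i (coordAlg h k) = if i = k then 1 else 0 := by
  rw [coordAlg, smoothDeriv_toSmoothAlg]
  refine Subtype.ext (funext fun q => ?_)
  rw [toSmoothAlg_apply, partialDeriv_coordFun h q.2 i hk]
  split_ifs <;> rfl

theorem smoothDeriv_pole (h : IsAdmissible S p₀) : smoothDeriv h (Sum.inr p₀) = 0 :=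
  Derivation.ext fun a => Subtype.ext (funext fun q =>
    partialDeriv_pole h q.2 (isSmoothFunOn_extendZero a))

theorem isDualFrame (h : IsAdmissible S p₀)
    (hstar : ∀ z ∈ S, ∀ j k : Fin n, z j * dualCoord S j z + z k * dualCoord S k z ≠ 0) :
    IsDualFrame p₀ (fun j => coordAlg h (Sum.inl j)) (fun j => coordAlg h (Sum.inr j))
      (fun j => smoothDeriv h (Sum.inl j)) (fun j => smoothDeriv h (Sum.inr j)) where
  sum_mul := Subtype.ext (funext fun q => by
    have h1 := sum_mul_dualCoord h.smooth h.origin q.2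
    have h2 : ((∑ j, coordAlg h (Sum.inl j) * coordAlg h (Sum.inr j) : smoothAlg S) : S → ℂ) q
        = ∑ j, (q : Cn n) j * dualCoord S j q := by
      rw [AddSubmonoidClass.coe_finsetSum, Finset.sum_apply]; rfl
    rw [h2, h1]; rfl)
  isUnit j := isUnit_toSmoothAlg _ fun z hz h0 => hstar z hz j j (by
    have : z j = 0 := h0
    rw [this]; ring)
  isUnit_pair j k := isUnit_toSmoothAlg
    (((isSmoothFunOn_coordFun h (Sum.inl j)).mul (isSmoothFunOn_coordFun h (Sum.inr j))).add
      ((isSmoothFunOn_coordFun h (Sum.inl k)).mul (isSmoothFunOn_coordFun h (Sum.inr k))))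
    fun z hz => hstar z hz j k
  Z_z j k := by simp [smoothDeriv_coordAlg h]
  W_z j k := by simp [smoothDeriv_coordAlg h]
  Z_w j k hk := by simp [smoothDeriv_coordAlg h, hk]
  W_w j k _ hk := by simp [smoothDeriv_coordAlg h, hk]
  W_pole := smoothDeriv_pole h
  comm_ZZ j k := smoothDeriv_comm h _ _
  comm_WZ j k := smoothDeriv_comm h _ _
  comm_WW j k := smoothDeriv_comm h _ _

/-! ### The vector fields in coordinates -/

theorem along_congr {V : Cn n → CVec n} {u u' : Cn n → ℂ} (hp : p ∈ S)
    (h : ∀ z ∈ S, u z = u' z) : along S V u p = along S V u' p := by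
  rw [along, along, tDeriv_congr_of_eqOn hp h, tDeriv_congr_of_eqOn hp h]

theorem along_add_csmul (V V' : Cn n → CVec n) (c c' : ℂ) (u : Cn n → ℂ) (p : Cn n) :
    along S (fun z => csmul c (V z) + csmul c' (V' z)) u p
      = c * along S V u p + c' * along S V' u p := by
  simp only [along, csmul, Prod.fst_add, Prod.snd_add, tDeriv_vec_add, tDeriv_vec_sub,
    tDeriv_vec_smul]
  linear_combination (-(c.im * tDeriv S u p (V p).2) - c'.im * tDeriv S u p (V' p).2)
    * Complex.I_mul_I
    + (tDeriv S u p (V p).1 + Complex.I * tDeriv S u p (V p).2) * Complex.re_add_im c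
    + (tDeriv S u p (V' p).1 + Complex.I * tDeriv S u p (V' p).2) * Complex.re_add_im c'

theorem IsFieldWith.along_eq (h : IsAdmissible S p₀) {a b : Fin n → Cn n → ℂ}
    {V : Cn n → CVec n} (hV : IsFieldWith S a b V) (hp : p ∈ S) {u : Cn n → ℂ}
    (hu : IsSmoothFunOn S u) :
    along S V u p = ∑ j, partialDeriv S p₀ (Sum.inl j) u p * a j p
      + ∑ j, partialDeriv S p₀ (Sum.inr j) u p * b j p := by
  obtain ⟨⟨h1, h2⟩, hab⟩ := hV p hp
  rw [along, tDeriv_eq_sum_partialDeriv h hp hu h1, tDeriv_eq_sum_partialDeriv h hp hu h2,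
    Finset.mul_sum, ← Finset.sum_add_distrib, Fintype.sum_sum_type]
  congr 1 <;> refine Finset.sum_congr rfl fun j _ => ?_
  · rw [← (hab j).1, along]
    simp only [coordFun, Sum.elim_inl]; ring
  · rw [← (hab j).2, along]
    simp only [coordFun, Sum.elim_inr]; ring

theorem exists_isFieldWith (h : IsAdmissible S p₀) (a b : Fin n → Cn n → ℂ)
    (hab : ∀ p ∈ S, ∑ j, (p j * b j p + a j p * dualCoord S j p) = 0) :
    ∃ V, IsFieldWith S a b V := by
  choose! x hx y hy hz hw using fun (p : Cn n) (hp : p ∈ S) => exists_tangent_dz_dw_eq h.smooth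
    h.origin h.hessian hp (h.pole p hp) (fun j => a j p) (fun j => b j p) (hab p hp)
  refine ⟨fun p => (x p, y p), fun p hp => ⟨⟨hx p hp, hy p hp⟩, fun l => ⟨?_, hw p hp l⟩⟩⟩
  rw [along, tDeriv_coord h.smooth hp l (hx p hp), tDeriv_coord h.smooth hp l (hy p hp)]
  exact hz p hp l

theorem sum_mul_rotCoeff (c : Fin n → Cn n → ℂ) (f : Fin n → ℂ) {j k : Fin n} (hjk : j ≠ k)
    (p : Cn n) : ∑ l, f l * rotCoeff c j k l p = f j * c k p - f k * c j p := by
  have : ∀ l, f l * rotCoeff c j k l p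
      = (if l = j then f j * c k p else 0) + (if l = k then -(f k * c j p) else 0) := by
    intro l
    by_cases hlj : l = j
    · subst hlj; simp [rotCoeff, hjk]
    · by_cases hlk : l = k
      · subst hlk; simp [rotCoeff, hjk.symm]
      · simp [rotCoeff, hlj, hlk]
  simp only [this, Finset.sum_add_distrib, Finset.sum_ite_eq', Finset.mem_univ, if_true]
  ring

theorem isFieldWith_fieldX (h : IsAdmissible S p₀) {j k : Fin n} (hjk : j ≠ k) :
    IsFieldWith S (fun _ _ => 0) (rotCoeff (fun i z => z i) j k) (fieldX S j k) := by
  rw [fieldX, if_neg hjk]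
  refine Classical.epsilon_spec (exists_isFieldWith h _ _ fun p hp => ?_)
  simp only [zero_mul, add_zero]
  rw [sum_mul_rotCoeff _ p hjk]; ring

theorem isFieldWith_fieldT (h : IsAdmissible S p₀) {j k : Fin n} (hjk : j ≠ k) :
    IsFieldWith S (rotCoeff (dualCoord S) j k) (fun _ _ => 0) (fieldT S j k) := by
  rw [fieldT, if_neg hjk]
  refine Classical.epsilon_spec (exists_isFieldWith h _ _ fun p hp => ?_)
  have := sum_mul_rotCoeff (dualCoord S) (fun l => dualCoord S l p) hjk p
  simp only [mul_zero, zero_add]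
  rw [← sub_self (dualCoord S j p * dualCoord S k p)]
  refine Eq.trans (Finset.sum_congr rfl fun l _ => mul_comm _ _) (this.trans ?_)
  ring

theorem along_fieldX (h : IsAdmissible S p₀) {j k : Fin n} (hjk : j ≠ k) (hp : p ∈ S)
    {u : Cn n → ℂ} (hu : IsSmoothFunOn S u) :
    along S (fieldX S j k) u p = p k * partialDeriv S p₀ (Sum.inr j) u p
      - p j * partialDeriv S p₀ (Sum.inr k) u p := by
  rw [(isFieldWith_fieldX h hjk).along_eq h hp hu, sum_mul_rotCoeff _ _ hjk]
  simp only [mul_zero, Finset.sum_const_zero]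
  ring

theorem along_fieldT (h : IsAdmissible S p₀) {j k : Fin n} (hjk : j ≠ k) (hp : p ∈ S)
    {u : Cn n → ℂ} (hu : IsSmoothFunOn S u) :
    along S (fieldT S j k) u p = dualCoord S k p * partialDeriv S p₀ (Sum.inl j) u p
      - dualCoord S j p * partialDeriv S p₀ (Sum.inl k) u p := by
  rw [(isFieldWith_fieldT h hjk).along_eq h hp hu, sum_mul_rotCoeff _ _ hjk]
  simp only [mul_zero, Finset.sum_const_zero]
  ring

/-- The operators `X_{jk} T̃_{jkl}` on functions, in terms of the derivations of `smoothAlg S`. -/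
theorem along_fieldX_fieldTt (h : IsAdmissible S p₀) {j k l : Fin n} (hjk : j ≠ k) (hjl : j ≠ l)
    (hkl : k ≠ l) {u : Cn n → ℂ} (hu : IsSmoothFunOn S u) (q : S) :
    along S (fieldX S j k) (along S (fieldTt S j k l) u) q
      = (IsDualFrame.X (fun j => coordAlg h (Sum.inl j)) (fun j => smoothDeriv h (Sum.inr j)) j k
          (IsDualFrame.Tt (fun j => coordAlg h (Sum.inl j)) (fun j => coordAlg h (Sum.inr j))
            (fun j => smoothDeriv h (Sum.inl j)) j k l (toSmoothAlg u hu))).1 q := by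
  set t := IsDualFrame.Tt (fun j => coordAlg h (Sum.inl j)) (fun j => coordAlg h (Sum.inr j))
            (fun j => smoothDeriv h (Sum.inl j)) j k l (toSmoothAlg u hu) with ht
  have h1 : ∀ z ∈ S, along S (fieldTt S j k l) u z = extendZero t.1 z := by
    intro z hz
    have e : along S (fieldTt S j k l) u z
        = z j * along S (fieldT S l j) u z + z k * along S (fieldT S l k) u z :=
      along_add_csmul (fieldT S l j) (fieldT S l k) (z j) (z k) u z
    rw [e, along_fieldT h hjl.symm hz hu, along_fieldT h hkl.symm hz hu, extendZero_of_mem _ hz, ht]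
    simp only [IsDualFrame.Tt, smoothDeriv_toSmoothAlg h _ hu]
    rfl
  rw [along_congr q.2 h1, along_fieldX h hjk q.2 (isSmoothFunOn_extendZero t),
    IsDualFrame.X_apply]
  rfl

/-! ### CR functions and dual-CR functions in coordinates -/

theorem partialDeriv_inr_eq_zero_of_isCR (h : IsAdmissible S p₀) {f : Cn n → ℂ} (hf : IsCR S f)
    (hp : p ∈ S) (j : Fin n) : partialDeriv S p₀ (Sum.inr j) f p = 0 := by
  by_cases hj : j = p₀
  · rw [hj, partialDeriv_pole h hp hf.1]
  have h1 := along_fieldX h hj hp hf.1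
  rw [partialDeriv_pole h hp hf.1, mul_zero, sub_zero] at h1
  obtain ⟨⟨ha, hb⟩, hV⟩ := isFieldWith_fieldX h hj p hp
  set a := (fieldX S j p₀ p).1
  set b := (fieldX S j p₀ p).2
  have hab : a = -(Complex.I • b) := by
    ext l
    have := (hV l).1
    rw [along, tDeriv_coord h.smooth hp l ha, tDeriv_coord h.smooth hp l hb] at this
    simp only [Pi.neg_apply, Pi.smul_apply, smul_eq_mul]
    linear_combination this
  have hIb : Complex.I • b ∈ tangent S p := by
    have := neg_mem ha
    rwa [hab, neg_neg] at this
  have h2 : tDeriv S f p (Complex.I • b) = Complex.I * tDeriv S f p b :=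
    hf.2 p hp ⟨b, hb, hIb⟩
  have h3 : along S (fieldX S j p₀) f p = tDeriv S f p a + Complex.I * tDeriv S f p b := rfl
  rw [h3, hab, tDeriv_vec_neg, h2, neg_add_cancel] at h1
  exact (mul_eq_zero.1 h1.symm).resolve_left (h.pole p hp)

/-- A complex tangent vector that annihilates all the `w_j` lies in `H_p S ⊗ ℂ`. -/
theorem mem_cTangent_of_dw_eq_zero (h : IsAdmissible S p₀) (hp : p ∈ S) {a b : Cn n}
    (ha : a ∈ tangent S p) (hb : b ∈ tangent S p)
    (hw : ∀ j, tDeriv S (dualCoord S j) p a + Complex.I * tDeriv S (dualCoord S j) p b = 0) :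
    a ∈ cTangent S p ∧ b ∈ cTangent S p := by
  obtain ⟨ρ, hρ⟩ := h.smooth p hp
  have h1 := sum_mul_tDeriv_dualCoord h.smooth h.origin hp ha
  have h2 := sum_mul_tDeriv_dualCoord h.smooth h.origin hp hb
  have h3 : ∑ j, a j * dualCoord S j p + Complex.I * ∑ j, b j * dualCoord S j p = 0 := by
    have : ∑ j, p j * tDeriv S (dualCoord S j) p a
        + Complex.I * ∑ j, p j * tDeriv S (dualCoord S j) p b = 0 := by
      rw [Finset.mul_sum, ← Finset.sum_add_distrib]
      exact Finset.sum_eq_zero fun j _ => by linear_combination p j * hw j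
    linear_combination h1 + Complex.I * h2 - this
  have hN := sum_mul_wirtinger_ne_zero h.origin hp hρ
  have h4 : ∀ v ∈ tangent S p, (∑ j, v j * dualCoord S j p)
      = -(Complex.I * (fderiv ℝ ρ p (Complex.I • v) : ℂ))
        / (2 * ∑ i, p i * wirtinger ρ p i) := by
    intro v hv
    simp only [dualCoord_eq hp hρ, dualFormula, ← mul_div_assoc]
    rw [← Finset.sum_div, sum_mul_wirtinger, (mem_tangent_iff hp hρ v).1 hv]
    field_simp
    simp
  rw [h4 a ha, h4 b hb, ← mul_div_assoc, ← add_div, div_eq_zero_iff,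
    or_iff_left (mul_ne_zero two_ne_zero hN)] at h3
  have h5 := congrArg Complex.re h3
  have h6 := congrArg Complex.im h3
  simp at h5 h6
  exact ⟨⟨ha, (mem_tangent_iff hp hρ _).2 h6⟩, ⟨hb, (mem_tangent_iff hp hρ _).2 h5⟩⟩

theorem along_fieldT_eq_zero_of_isDualCR (h : IsAdmissible S p₀) {g : Cn n → ℂ}
    (hg : IsDualCR S g) (hp : p ∈ S) {j k : Fin n} (hjk : j ≠ k) :
    along S (fieldT S j k) g p = 0 := by
  obtain ⟨-, J, ⟨-, hJw⟩, hJg⟩ := hg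
  obtain ⟨⟨ha, hb⟩, hV⟩ := isFieldWith_fieldT h hjk p hp
  have h3 : along S (fieldT S j k) g p = tDeriv S g p (fieldT S j k p).1
    + Complex.I * tDeriv S g p (fieldT S j k p).2 := rfl
  rw [h3]
  set a := (fieldT S j k p).1
  set b := (fieldT S j k p).2
  have hw : ∀ l, tDeriv S (dualCoord S l) p a + Complex.I * tDeriv S (dualCoord S l) p b = 0 :=
    fun l => (hV l).2
  obtain ⟨haH, hbH⟩ := mem_cTangent_of_dw_eq_zero h hp ha hb hw
  have hsum : a + (J p ⟨b, hbH⟩ : Cn n) = 0 := by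
    refine eq_zero_of_tDeriv_dualCoord_eq_zero h.smooth h.origin h.hessian hp
      (add_mem haH (J p ⟨b, hbH⟩).2) fun l => ?_
    rw [tDeriv_vec_add, hJw l p hp ⟨b, hbH⟩]
    exact hw l
  rw [eq_neg_of_add_eq_zero_left hsum, tDeriv_vec_neg, hJg p hp ⟨b, hbH⟩]
  ring

/-- The differentials of the dual coordinates map `H_p S` onto a complex subspace, namely the
orthogonal complement of `p`. -/
theorem exists_tDeriv_dualCoord_eq_I_mul (h : IsAdmissible S p₀) (hp : p ∈ S) {v : Cn n}
    (hv : v ∈ cTangent S p) : ∃ x ∈ cTangent S p,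
      ∀ j, tDeriv S (dualCoord S j) p x = Complex.I * tDeriv S (dualCoord S j) p v := by
  let θ : Cn n → ℂ := fun v => ∑ j, v j * dualCoord S j p
  have hθp : θ p = 1 := sum_mul_dualCoord h.smooth h.origin hp
  have hθadd : ∀ v w, θ (v + w) = θ v + θ w := fun v w => by
    simp only [θ, Pi.add_apply, add_mul, Finset.sum_add_distrib]
  have hθsmul : ∀ (c : ℂ) v, θ (c • v) = c * θ v := fun c v => by
    simp only [θ, Pi.smul_apply, smul_eq_mul, Finset.mul_sum, mul_assoc]
  have hθrsmul : ∀ (c : ℝ) v, θ (c • v) = c * θ v := fun c v => by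
    simp only [θ, Pi.smul_apply, Complex.real_smul, Finset.mul_sum, mul_assoc]
  have hmem : ∀ v, v ∈ cTangent S p ↔ θ v = 0 :=
    mem_cTangent_iff_dualCoord h.smooth h.origin hp
  let P : Cn n → Cn n := fun v => v - θ v • p
  have hP : ∀ v, P v ∈ cTangent S p := fun v => by
    have e : P v = v + (-θ v) • p := by simp only [P, neg_smul, sub_eq_add_neg]
    rw [hmem, e, hθadd, hθsmul, hθp]; ring
  have hdot : ∀ v ∈ cTangent S p, ∑ j, p j * tDeriv S (dualCoord S j) p v = 0 := by
    intro v hv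
    have := sum_mul_tDeriv_dualCoord h.smooth h.origin hp hv.1
    rwa [(mem_cTangent_iff_dualCoord h.smooth h.origin hp v).1 hv, add_zero] at this
  -- The map `dw` on `H_p S`, extended to an endomorphism of `ℂⁿ` by sending `p` to `(w_j)`.
  let G : Cn n →ₗ[ℝ] Cn n :=
    { toFun := fun v j => tDeriv S (dualCoord S j) p (P v) + θ v * dualCoord S j p
      map_add' := fun v w => by
        have e : P (v + w) = P v + P w := by
          simp only [P, hθadd, add_smul]; abel
        ext j
        simp only [e, hθadd, tDeriv_vec_add, Pi.add_apply]; ring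
      map_smul' := fun c v => by
        have e : P (c • v) = c • P v := by
          ext i
          simp only [P, hθrsmul, Pi.sub_apply, Pi.smul_apply, smul_eq_mul, Complex.real_smul]
          ring
        ext j
        simp only [e, hθrsmul, tDeriv_vec_smul, Pi.smul_apply, Complex.real_smul,
          RingHom.id_apply]
        ring }
  have hGa : ∀ v j, G v j = tDeriv S (dualCoord S j) p (P v) + θ v * dualCoord S j p :=
    fun v j => rfl
  have hGdot : ∀ v, ∑ j, p j * G v j = θ v := by
    intro v
    have : ∑ j, p j * G v j = ∑ j, p j * tDeriv S (dualCoord S j) p (P v)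
        + θ v * ∑ j, p j * dualCoord S j p := by
      rw [Finset.mul_sum, ← Finset.sum_add_distrib]
      exact Finset.sum_congr rfl fun j _ => by rw [hGa]; ring
    rw [this, hdot _ (hP v), sum_mul_dualCoord h.smooth h.origin hp]; ring
  have hGH : ∀ v, θ v = 0 → ∀ j, G v j = tDeriv S (dualCoord S j) p v := by
    intro v hv j
    have e : P v = v := by simp only [P, hv, zero_smul, sub_zero]
    rw [hGa, e, hv, zero_mul, add_zero]
  have hinj : Function.Injective G := by
    rw [injective_iff_map_eq_zero]
    intro v hv
    have h0 : θ v = 0 := by rw [← hGdot, hv]; simp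
    refine eq_zero_of_tDeriv_dualCoord_eq_zero h.smooth h.origin h.hessian hp ((hmem v).2 h0)
      fun j => ?_
    rw [← hGH v h0, hv]; rfl
  obtain ⟨x, hx⟩ := (LinearMap.injective_iff_surjective (f := G)).1 hinj
    (fun j => Complex.I * tDeriv S (dualCoord S j) p v)
  have hx0 : θ x = 0 := by
    rw [← hGdot, hx, ← mul_zero Complex.I, ← hdot v hv, Finset.mul_sum]
    exact Finset.sum_congr rfl fun j _ => by ring
  exact ⟨x, (hmem x).2 hx0, fun j => by rw [← hGH x hx0, hx]⟩

theorem exists_isDualStructure (h : IsAdmissible S p₀) : ∃ J : EndField S, IsDualStructure S J := by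
  have key : ∀ p : Cn n, ∃ Jp : cTangent S p →ₗ[ℝ] cTangent S p, p ∈ S →
      (∀ v, Jp (Jp v) = -v) ∧ ∀ j, ∀ v : cTangent S p,
        tDeriv S (dualCoord S j) p (Jp v) = Complex.I * tDeriv S (dualCoord S j) p v := by
    intro p
    by_cases hp : p ∈ S
    swap
    · exact ⟨0, fun h => absurd h hp⟩
    have hinj : ∀ a b : cTangent S p,
        (∀ j, tDeriv S (dualCoord S j) p a = tDeriv S (dualCoord S j) p b) → a = b := by
      intro a b hab
      have := eq_zero_of_tDeriv_dualCoord_eq_zero h.smooth h.origin h.hessian hp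
        (sub_mem a.2 b.2) fun j => by rw [tDeriv_vec_sub, hab, sub_self]
      exact Subtype.ext (sub_eq_zero.1 this)
    choose φ hφH hφ using fun v : cTangent S p => exists_tDeriv_dualCoord_eq_I_mul h hp v.2
    refine ⟨{ toFun := fun v => ⟨φ v, hφH v⟩
              map_add' := fun v w => hinj _ _ fun j => ?_
              map_smul' := fun c v => hinj _ _ fun j => ?_ }, fun _ => ⟨fun v => ?_, fun j v => ?_⟩⟩
    · simp only [hφ, Submodule.coe_add, tDeriv_vec_add]; ring
    · simp only [hφ, RingHom.id_apply, Submodule.coe_smul_of_tower, tDeriv_vec_smul]; ring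
    · refine hinj _ _ fun j => ?_
      simp only [LinearMap.coe_mk, AddHom.coe_mk, hφ, Submodule.coe_neg, tDeriv_vec_neg]
      linear_combination tDeriv S (dualCoord S j) p v * Complex.I_mul_I
    · exact hφ v j
  choose J hJ using key
  exact ⟨J, fun p hp => (hJ p hp).1, fun j p hp => (hJ p hp).2 j⟩

end

/-! ### The equivalence -/

section

variable {n : ℕ} {S : Set (Cn n)} {p₀ : Fin n}

theorem along_eq_zero_of_eq_add (h : IsAdmissible S p₀)
    (hstar : ∀ z ∈ S, ∀ j k : Fin n, z j * dualCoord S j z + z k * dualCoord S k z ≠ 0)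
    {u f g : Cn n → ℂ} (hu : IsSmoothFunOn S u) (hf : IsCR S f) (hg : IsDualCR S g)
    (hfg : ∀ z ∈ S, u z = f z + g z) {j k l : Fin n} (hjk : j ≠ k) (hjl : j ≠ l) (hkl : k ≠ l)
    {z : Cn n} (hz : z ∈ S) : along S (fieldX S j k) (along S (fieldTt S j k l) u) z = 0 := by
  have hF := isDualFrame h hstar
  have hu' : toSmoothAlg u hu = toSmoothAlg f hf.1 + toSmoothAlg g hg.1 :=
    Subtype.ext (funext fun q => hfg q q.2)
  have hWf : ∀ i, smoothDeriv h (Sum.inr i) (toSmoothAlg f hf.1) = 0 := fun i => by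
    rw [smoothDeriv_toSmoothAlg]
    exact Subtype.ext (funext fun q => partialDeriv_inr_eq_zero_of_isCR h hf q.2 i)
  have hTg : ∀ i i', i ≠ i' → coordAlg h (Sum.inr i') * smoothDeriv h (Sum.inl i)
        (toSmoothAlg g hg.1) - coordAlg h (Sum.inr i) * smoothDeriv h (Sum.inl i')
        (toSmoothAlg g hg.1) = 0 := fun i i' hii => by
    rw [smoothDeriv_toSmoothAlg, smoothDeriv_toSmoothAlg]
    refine Subtype.ext (funext fun q => ?_)
    have h1 := along_fieldT_eq_zero_of_isDualCR h hg q.2 hii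
    rwa [along_fieldT h hii q.2 hg.1] at h1
  have hTt : IsDualFrame.Tt (fun j => coordAlg h (Sum.inl j)) (fun j => coordAlg h (Sum.inr j))
      (fun j => smoothDeriv h (Sum.inl j)) j k l (toSmoothAlg u hu)
      = IsDualFrame.Tt (fun j => coordAlg h (Sum.inl j)) (fun j => coordAlg h (Sum.inr j))
      (fun j => smoothDeriv h (Sum.inl j)) j k l (toSmoothAlg f hf.1) := by
    simp only [IsDualFrame.Tt, hu', map_add]
    linear_combination coordAlg h (Sum.inl j) * hTg l j hjl.symm
      + coordAlg h (Sum.inl k) * hTg l k hkl.symm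
  rw [along_fieldX_fieldTt h hjk hjl hkl hu ⟨z, hz⟩, hTt,
    hF.X_Tt_eq_zero_of_W_eq_zero hjk hjl hkl hWf]
  rfl

theorem exists_eq_add_of_along_eq_zero (h : IsAdmissible S p₀) (hn : 2 < n)
    (hsc : SimplyConnectedSpace S)
    (hstar : ∀ z ∈ S, ∀ j k : Fin n, z j * dualCoord S j z + z k * dualCoord S k z ≠ 0)
    {u : Cn n → ℂ} (hu : IsSmoothFunOn S u)
    (hXT : ∀ j k l : Fin n, j ≠ k → j ≠ l → k ≠ l →
      ∀ z ∈ S, along S (fieldX S j k) (along S (fieldTt S j k l) u) z = 0) :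
    ∃ f g : Cn n → ℂ, IsCR S f ∧ IsDualCR S g ∧ ∀ z ∈ S, u z = f z + g z := by
  have hF := isDualFrame h hstar
  have hcard : 2 < Fintype.card (Fin n) := by simpa using hn
  obtain ⟨lam, hW⟩ := hF.exists_W_eq_zero hcard (u := toSmoothAlg u hu)
    fun j k l hjk hjl hkl => Subtype.ext (funext fun q => by
      rw [← along_fieldX_fieldTt h hjk hjl hkl hu, hXT j k l hjk hjl hkl q q.2]; rfl)
  have hZ := hF.Z_comm_of_W_eq_zero hcard hW
  set C : Fin n → smoothAlg S := fun j =>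
    smoothDeriv h (Sum.inl j) (toSmoothAlg u hu) - lam * coordAlg h (Sum.inr j) with hC
  have hCs := fun j => isSmoothFunOn_extendZero (C j)
  have hCW : ∀ i j, ∀ z ∈ S, partialDeriv S p₀ (Sum.inr i) (extendZero (C j).1) z = 0 :=
    fun i j z hz => congrFun (congrArg Subtype.val (hW i j)) ⟨z, hz⟩
  have hCZ : ∀ j k, ∀ z ∈ S, partialDeriv S p₀ (Sum.inl k) (extendZero (C j).1) z
      = partialDeriv S p₀ (Sum.inl j) (extendZero (C k).1) z :=
    fun j k z hz => congrFun (congrArg Subtype.val (hZ j k)) ⟨z, hz⟩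
  have hCd : ∀ j, ∀ z ∈ S, ∀ v ∈ tangent S z, tDeriv S (extendZero (C j).1) z v
      = ∑ k, partialDeriv S p₀ (Sum.inl k) (extendZero (C j).1) z * v k := by
    intro j z hz v hv
    rw [tDeriv_eq_sum_partialDeriv h hz (hCs j) hv, Fintype.sum_sum_type]
    simp only [hCW _ j z hz, zero_mul, Finset.sum_const_zero, add_zero]
    exact Finset.sum_congr rfl fun k _ => by rw [← tDeriv_coord h.smooth hz k hv]; rfl
  obtain ⟨f, hfs, hfd⟩ := exists_primitive h.smooth hsc hCs (by
    intro z hz a ha b hb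
    simp only [hCd _ z hz a ha, hCd _ z hz b hb, Finset.sum_mul]
    rw [Finset.sum_comm]
    refine Finset.sum_congr rfl fun j _ => Finset.sum_congr rfl fun k _ => ?_
    rw [hCZ k j z hz]; ring)
  have hgs : IsSmoothFunOn S (fun z => u z + (-1) * f z) :=
    hu.add ((isSmoothFunOn_const (-1)).mul hfs)
  refine ⟨f, fun z => u z + (-1) * f z, ⟨hfs, fun p hp v => ?_⟩, ⟨hgs, ?_⟩, fun z _ => by ring⟩
  · have e : (stdJ S p v : Cn n) = Complex.I • (v : Cn n) := rfl
    rw [e, hfd p hp _ v.2.2, hfd p hp _ v.2.1, Finset.mul_sum]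
    exact Finset.sum_congr rfl fun j _ => by rw [Pi.smul_apply, smul_eq_mul]; ring
  · obtain ⟨J, hJ⟩ := exists_isDualStructure h
    refine ⟨J, hJ, fun p hp v => ?_⟩
    -- On `H_p S` the terms `λ ∑ w_j dz_j` drop out, so that `dg` is a combination of the `dw_j`.
    have hgd : ∀ x ∈ cTangent S p, tDeriv S (fun z => u z + (-1) * f z) p x
        = ∑ j, partialDeriv S p₀ (Sum.inr j) u p * tDeriv S (dualCoord S j) p x := by
      intro x hx
      have hθ := (mem_cTangent_iff_dualCoord h.smooth h.origin hp x).1 hx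
      have hCj : ∀ j, extendZero (C j).1 p
          = partialDeriv S p₀ (Sum.inl j) u p - lam.1 ⟨p, hp⟩ * dualCoord S j p := by
        intro j
        rw [extendZero_of_mem _ hp, hC]
        simp only [smoothDeriv_toSmoothAlg h _ hu]
        rfl
      have hsum : ∑ j, extendZero (C j).1 p * x j
          = ∑ j, partialDeriv S p₀ (Sum.inl j) u p * x j := by
        have : ∑ j, extendZero (C j).1 p * x j = ∑ j, partialDeriv S p₀ (Sum.inl j) u p * x j
            - lam.1 ⟨p, hp⟩ * ∑ j, x j * dualCoord S j p := by
          rw [Finset.mul_sum, ← Finset.sum_sub_distrib]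
          exact Finset.sum_congr rfl fun j _ => by rw [hCj]; ring
        rw [this, hθ, mul_zero, sub_zero]
      have hz : ∑ j, partialDeriv S p₀ (Sum.inl j) u p * tDeriv S (coordFun S (Sum.inl j)) p x
          = ∑ j, partialDeriv S p₀ (Sum.inl j) u p * x j :=
        Finset.sum_congr rfl fun j _ => by rw [← tDeriv_coord h.smooth hp j hx.1]; rfl
      rw [tDeriv_add h.smooth hp hu ((isSmoothFunOn_const (-1)).mul hfs) hx.1,
        tDeriv_mul h.smooth hp (isSmoothFunOn_const (-1)) hfs hx.1,
        tDeriv_const h.smooth hp _ hx.1, hfd p hp x hx.1, hsum,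
        tDeriv_eq_sum_partialDeriv h hp hu hx.1, Fintype.sum_sum_type, hz]
      simp only [coordFun, Sum.elim_inr]
      ring
    rw [hgd _ (J p v).2, hgd _ v.2, Finset.mul_sum]
    exact Finset.sum_congr rfl fun j _ => by rw [hJ.2 j p hp v]; ring

end

end DualCR

end

theorem theoremB (n : ℕ) (hn : 2 < n) (S : Set (Cn n))
    (hconv : IsStronglyCConvex S) (hsc : SimplyConnectedSpace S)
    (horigin : ComplexTangentsAvoidOrigin S)
    (hstar : ∀ z ∈ S, ∀ j k : Fin n, z j * dualCoord S j z + z k * dualCoord S k z ≠ 0)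
    (u : Cn n → ℂ) (hu : IsSmoothFunOn S u) :
    (∃ f g : Cn n → ℂ, IsCR S f ∧ IsDualCR S g ∧ ∀ z ∈ S, u z = f z + g z) ↔
      ∀ j k l : Fin n, j ≠ k → j ≠ l → k ≠ l →
        ∀ z ∈ S, along S (fieldX S j k) (along S (fieldTt S j k l) u) z = 0 := by
  have h : IsAdmissible S (⟨0, by lia⟩ : Fin n) :=
    ⟨hconv.1, horigin, hconv.hasPositiveHessian, fun z hz h0 => hstar z hz _ _ (by
      rw [h0, zero_mul, add_zero])⟩
  constructor
  · rintro ⟨f, g, hf, hg, hfg⟩ j k l hjk hjl hkl z hz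
    exact along_eq_zero_of_eq_add h hstar hu hf hg hfg hjk hjl hkl hz
  · exact exists_eq_add_of_along_eq_zero h hn hsc hstar hu
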